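/- **Setting.** Let $(\mathcal X,d_{\mathcal X})$ and $(\mathcal Y,d_{\mathcal Y})$ be complete separable metric spaces, $(\varepsilon_i)_{i\ge1}$ independent copies of a $\mathcal Y$-valued random variable $\varepsilon$ with law $\mathbb P_\varepsilon$, and $X_1$ an $\mathcal X$-valued random variable with law $\mathbb P_{X_1}$, independent of $(\varepsilon_i)_{i\ge2}$. Let $X_n=F_n(X_{n-1},\varepsilon_n)$ for $n\ge2$, where the maps $F_n:\mathcal X\times\mathcal Y\to\mathcal X$ are measurable and, for all $n\ge 2$, $x,x'\in\mathcal X$, $y,y'\in\mathcal Y$, $$\mathbb E\big[d_{\mathcal X}(F_n(x,\varepsilon),F_n(x',\varepsilon))\big]\le\rho_n\,d_{\mathcal X}(x,x'),\qquad d_{\mathcal X}(F_n(x,y),F_n(x,y'))\le\tau_n\,d_{\mathcal Y}(y,y')+\xi_n,$$ with $\rho_n\in[0,1)$ and $\tau_n,\xi_n\ge0$. Put $G_{X_1}(x)=\int d_{\mathcal X}(x,x')\,\mathbb P_{X_1}(dx')$, $G_\varepsilon(y)=\int d_{\mathcal Y}(y,y')\,\mathbb P_\varepsilon(dy')$ (values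 in $[0,\infty]$), and $K_{k,n}=1+\rho_{k+1}+\rho_{k+1}\rho_{k+2}+\dots+\rho_{k+1}\cdots\rho_n$ for $1\le k<n$, $K_{n,n}=1$. Let $d\ge1$, $p\in[1,\infty]$, and for every $n\ge2$ let $f_n:\mathcal X^n\to\mathbb R^d$ satisfy $\|f_n(x_1,\dots,x_n)-f_n(x_1',\dots,x_n')\|_p\le\sum_{i=1}^n d_{\mathcal X}(x_i,x_i')$. Put $$S_n=f_n(X_1,\dots,X_n)-\mathbb E[f_n(X_1,\dots,X_n)],\qquad I_1(x)=d\;\mathbb P\Big(G_{X_1}(X_1)\ge\frac{x}{2K_{1,n}}\Big).$$ **Proposition.** Let $q\in(0,1)$ and assume that $\mathbb E\big[G_\varepsilon(\varepsilon)^2\exp\{G_\varepsilon(\varepsilon)^q\}\big]\le A_1$ for a constant $A_1>0$. For $n\ge2$ put $$V_n^2=2e\sum_{k=2}^nK_{k,n}^2\Big(\tau_k^2A_1+\xi_k^2\,\mathbb E\big[e^{G_\varepsilon(\varepsilon)^q}\big]\Big),\qquad\delta_n=\max\{K_{k,n}\tau_k,\;K_{k,n}\xi_k:\;k=2,\dots,n\}.$$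 If $n\ge2$ and $V_n\ge1$, then for all $x>0$ (with $d^{1/\infty}=1$) $$\mathbb P\big(\|S_n\|_p\ge d^{1/p}x\big)\le I_1(x)+4d\exp\Big\{-\frac{(x/2)^2}{2\big(V_n^2+(x/2)^{2-q}\delta_n^q\big)}\Big\}.$$ Assume moreover that there is $c>0$ with $\mathbb P(G_{X_1}(X_1)\ge x)\le c^{-1}e^{-cx^q}$ for all $x>0$. Below, $\rho\in(0,1)$ and $\eta>0$ are constants, $\ln 0=-\infty$, and $C_1,\dots,C_5$ are positive constants that depend only on $p,d,q,\alpha,\rho,\eta$ and, for $C_1,C_2$, also on $c$, for $C_4,C_5$, also on $A_1$ (so not on $x$, on $n$, or on anything else). Then the following hold for all $x>0$. [i] If $\alpha\in[0,1)$ and $\rho_n\le1-\rho/n^\alpha$, $\max\{\xi_n,\tau_n\}\le\eta/n^\alpha$ for all $n\ge2$, then $$\limsup_{n\to\infty}\frac1{n^q}\ln\mathbb P(\|S_n\|_p\ge nx)\le-C_1x^q.$$ If $\alpha\in(0,1]$ and $\rho_n\le\rho$, $\max\{\xi_n,\tau_n\}\le\eta/n^\alpha$ for all $n\ge2$, then the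 same holds with $C_2$ in place of $C_1$. [ii] Let $\alpha\in(0,1/2)$ and $\rho_n\le1-\rho/n^\alpha$, $\max\{\xi_n,\tau_n\}\le\eta$ for all $n\ge2$. If $\alpha<\frac{1-q}{2-q}$, then $$\limsup_{n\to\infty}\frac1{n^{q(1-\alpha)}}\ln\mathbb P(\|S_n\|_p\ge nx)\le-C_3x^q.$$ If $\alpha=\frac{1-q}{2-q}$, then $$\limsup_{n\to\infty}\frac1{n^{q/(2-q)}}\ln\mathbb P(\|S_n\|_p\ge nx)\le-C_4\big(x^q\mathbf 1_{\{x\ge1\}}+x^2\mathbf 1_{\{0<x<1\}}\big).$$ If $\frac{1-q}{2-q}<\alpha<\frac12$, then $$\limsup_{n\to\infty}\frac1{n^{1-2\alpha}}\ln\mathbb P(\|S_n\|_p\ge nx)\le-C_5x^2.$$ -/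

import Mathlib

open MeasureTheory ProbabilityTheory Filter
open scoped ENNReal

universe u v w

noncomputable section

namespace IteratedRandom

/-- The mean distance `x ↦ ∫ d(x, x') P(dx')`, with values in `[0, ∞]`.
With `P` the law of `X₁` it is `G_{X₁}`, with `P` the law of `ε` it is `G_ε`. -/
def meanDist {E : Type u} [MetricSpace E] [MeasurableSpace E] (P : Measure E) (x : E) : ℝ≥0∞ :=
  ∫⁻ x', edist x x' ∂P

/-- `exp (g ^ q)` for `g ∈ [0, ∞]`, with `exp ∞ = ∞`. -/
def expPow (q : ℝ) (g : ℝ≥0∞) : ℝ≥0∞ :=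
  EReal.exp ((g ^ q : ℝ≥0∞) : EReal)

/-- The non-homogeneous Markov chain `X n = F n (X (n-1)) (ε n)`, `n ≥ 2`, driven by i.i.d.
innovations `ε 1, ε 2, …` of law `Pε`, with an initial variable `X 1` independent of
`ε 2, ε 3, …`, under the mean contraction condition with coefficients `ρ n ∈ [0, 1)` and the
one-step regularity condition with coefficients `τ n, ξ n ≥ 0`. The values `X 0`, `ε 0`, `F 0`,
`F 1` and the coefficients of index `0` and `1` play no role. -/
structure IsChain {Ω : Type w} {𝒳 : Type u} {𝒴 : Type v} [MeasurableSpace Ω]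
    [MetricSpace 𝒳] [MeasurableSpace 𝒳] [MetricSpace 𝒴] [MeasurableSpace 𝒴]
    (μ : Measure Ω) (Pε : Measure 𝒴) (ε : ℕ → Ω → 𝒴) (X : ℕ → Ω → 𝒳)
    (F : ℕ → 𝒳 → 𝒴 → 𝒳) (ρ τ ξ : ℕ → ℝ) : Prop where
  measurable_noise : ∀ n, 1 ≤ n → Measurable (ε n)
  law_noise : ∀ n, 1 ≤ n → μ.map (ε n) = Pε
  indep_noise : iIndepFun (fun (i : ℕ) => ε (i + 1)) μ
  measurable_init : Measurable (X 1)
  indep_init : IndepFun (X 1) (fun ω (i : ℕ) => ε (i + 2) ω) μ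
  measurable_map : ∀ n, 2 ≤ n → Measurable (fun z : 𝒳 × 𝒴 => F n z.1 z.2)
  recursion : ∀ n, 2 ≤ n → ∀ ω, X n ω = F n (X (n - 1) ω) (ε n ω)
  rho_nonneg : ∀ n, 2 ≤ n → 0 ≤ ρ n
  rho_lt_one : ∀ n, 2 ≤ n → ρ n < 1
  tau_nonneg : ∀ n, 2 ≤ n → 0 ≤ τ n
  xi_nonneg : ∀ n, 2 ≤ n → 0 ≤ ξ n
  contract : ∀ n, 2 ≤ n → ∀ x x' : 𝒳,
    ∫⁻ y, edist (F n x y) (F n x' y) ∂Pε ≤ ENNReal.ofReal (ρ n) * edist x x'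
  regular : ∀ n, 2 ≤ n → ∀ (x : 𝒳) (y y' : 𝒴),
    dist (F n x y) (F n x y') ≤ τ n * dist y y' + ξ n

/-- `f : 𝒳ⁿ → ℝᵈ` is separately Lipschitz for the `Lᵖ`-norm on `ℝᵈ`. -/
def SepLipschitz {𝒳 : Type u} [MetricSpace 𝒳] {p : ℝ≥0∞} [Fact (1 ≤ p)] {d n : ℕ}
    (f : (Fin n → 𝒳) → PiLp p (fun _ : Fin d => ℝ)) : Prop :=
  ∀ x x' : Fin n → 𝒳, ‖f x - f x'‖ ≤ ∑ i, dist (x i) (x' i)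

/-- `S_n = f (X₁, …, X_n) - 𝔼[f (X₁, …, X_n)]`. -/
def centered {Ω : Type w} {𝒳 : Type u} [MeasurableSpace Ω] {p : ℝ≥0∞} [Fact (1 ≤ p)]
    {d n : ℕ} (μ : Measure Ω) (X : ℕ → Ω → 𝒳)
    (f : (Fin n → 𝒳) → PiLp p (fun _ : Fin d => ℝ)) (ω : Ω) : PiLp p (fun _ : Fin d => ℝ) :=
  f (fun i => X (i + 1) ω) - ∫ ω', f (fun i => X (i + 1) ω') ∂μ

/-- `K_{k,n} = 1 + ρ_{k+1} + ρ_{k+1} ρ_{k+2} + ⋯ + ρ_{k+1} ⋯ ρ_n`. -/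
def K (ρ : ℕ → ℝ) (k n : ℕ) : ℝ :=
  ∑ j ∈ Finset.Icc k n, ∏ i ∈ Finset.Ioc k j, ρ i

/-- `V_n² = 2e ∑_{k=2}^n K_{k,n}² (τ_k² A₁ + ξ_k² 𝔼[exp (G_ε(ε)^q)])`. The expectation is finite
as soon as `𝔼[G_ε(ε)² exp (G_ε(ε)^q)]` is. -/
def Vsq {𝒴 : Type v} [MetricSpace 𝒴] [MeasurableSpace 𝒴] (Pε : Measure 𝒴)
    (ρ τ ξ : ℕ → ℝ) (q A₁ : ℝ) (n : ℕ) : ℝ :=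
  2 * Real.exp 1 * ∑ k ∈ Finset.Icc 2 n, K ρ k n ^ 2 *
    (τ k ^ 2 * A₁ + ξ k ^ 2 * (∫⁻ y, expPow q (meanDist Pε y) ∂Pε).toReal)

/-- `δ_n = max {K_{k,n} τ_k, K_{k,n} ξ_k : k = 2, …, n}`, for `n ≥ 2`. -/
def delta (ρ τ ξ : ℕ → ℝ) (n : ℕ) : ℝ :=
  ⨆ k : Set.Icc 2 n, max (K ρ k n * τ k) (K ρ k n * ξ k)

/-- `I₁(x) = d ℙ(G_{X₁}(X₁) ≥ x / (2 K_{1,n}))`. -/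
def I₁ {Ω : Type w} {𝒳 : Type u} [MeasurableSpace Ω] [MetricSpace 𝒳] [MeasurableSpace 𝒳]
    (μ : Measure Ω) (X : ℕ → Ω → 𝒳) (ρ : ℕ → ℝ) (d n : ℕ) (x : ℝ) : ℝ :=
  d * μ.real {ω | ENNReal.ofReal (x / (2 * K ρ 1 n)) ≤ meanDist (μ.map (X 1)) (X 1 ω)}

/-- Coefficients with `ρ_n ≤ 1 - r / n^α` and `max (ξ_n, τ_n) ≤ η / n^α`, `α ∈ [0, 1)`. -/
def VanishingBoth (ρ τ ξ : ℕ → ℝ) (α r η : ℝ) : Prop :=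
  0 ≤ α ∧ α < 1 ∧ 0 < r ∧ r < 1 ∧ 0 < η ∧
    ∀ n : ℕ, 2 ≤ n → ρ n ≤ 1 - r / (n : ℝ) ^ α ∧ max (ξ n) (τ n) ≤ η / (n : ℝ) ^ α

/-- Coefficients with `ρ_n ≤ 1 - r / n^α` and `max (ξ_n, τ_n) ≤ η`, `α ∈ (0, 1)`. -/
def VanishingContraction (ρ τ ξ : ℕ → ℝ) (α r η : ℝ) : Prop :=
  0 < α ∧ α < 1 ∧ 0 < r ∧ r < 1 ∧ 0 < η ∧
    ∀ n : ℕ, 2 ≤ n → ρ n ≤ 1 - r / (n : ℝ) ^ α ∧ max (ξ n) (τ n) ≤ η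

/-- Coefficients with `ρ_n ≤ r` and `max (ξ_n, τ_n) ≤ η / n^α`, `α ∈ (0, 1]`. -/
def VanishingNoise (ρ τ ξ : ℕ → ℝ) (α r η : ℝ) : Prop :=
  0 < α ∧ α ≤ 1 ∧ 0 < r ∧ r < 1 ∧ 0 < η ∧
    ∀ n : ℕ, 2 ≤ n → ρ n ≤ r ∧ max (ξ n) (τ n) ≤ η / (n : ℝ) ^ α

/-- `limsup_{n → ∞} n^{-s} ln ℙ(‖S_n‖_p ≥ n x)` in `[-∞, ∞]`, with `ln 0 = -∞`. -/
def ldRate {Ω : Type w} {𝒳 : Type u} [MeasurableSpace Ω] {p : ℝ≥0∞} [Fact (1 ≤ p)] {d : ℕ}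
    (μ : Measure Ω) (X : ℕ → Ω → 𝒳)
    (f : (n : ℕ) → (Fin n → 𝒳) → PiLp p (fun _ : Fin d => ℝ)) (s x : ℝ) : EReal :=
  limsup (fun n : ℕ => ((1 / (n : ℝ) ^ s : ℝ) : EReal) *
    ENNReal.log (μ {ω | (n : ℝ) * x ≤ ‖centered μ X (f n) ω‖})) atTop

end IteratedRandom

end

set_option linter.unusedSectionVars false

namespace IteratedRandom


section RealAnalysis

lemma exp_le_of_nonneg {t : ℝ} (ht : 0 ≤ t) :
    Real.exp t ≤ 1 + t + t ^ 2 / 2 * Real.exp t := by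
  have hd : ∀ s : ℝ, HasDerivAt (fun s : ℝ => (1 + s) * Real.exp (-s) + s ^ 2 / 2)
      (s * (1 - Real.exp (-s))) s := by
    intro s
    have h1 : HasDerivAt (fun s : ℝ => Real.exp (-s)) (Real.exp (-s) * (-1)) s :=
      (hasDerivAt_id s).neg.exp
    have h2 := (((hasDerivAt_id s).const_add 1).mul h1).add (((hasDerivAt_id s).pow 2).div_const 2)
    refine h2.congr_deriv ?_
    simp
    ring
  have hm : Monotone (fun s : ℝ => (1 + s) * Real.exp (-s) + s ^ 2 / 2) := by
    refine monotone_of_deriv_nonneg (fun s => (hd s).differentiableAt) fun s => ?_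
    rw [(hd s).deriv]
    rcases le_total 0 s with hs | hs
    · exact mul_nonneg hs (by simpa using hs)
    · exact mul_nonneg_of_nonpos_of_nonpos hs (by simpa using hs)
  have h := hm ht
  simp only [add_zero, neg_zero, Real.exp_zero, mul_one, ne_eq, OfNat.ofNat_ne_zero,
    not_false_eq_true, zero_pow, zero_div] at h
  have h2 := mul_le_mul_of_nonneg_right h (Real.exp_pos t).le
  rw [add_mul, mul_assoc, ← Real.exp_add] at h2
  simp at h2
  linarith

lemma exp_le_of_nonpos {t : ℝ} (ht : t ≤ 0) : Real.exp t ≤ 1 + t + t ^ 2 / 2 := by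
  have hd : ∀ s : ℝ, HasDerivAt (fun s : ℝ => 1 + s + s ^ 2 / 2 - Real.exp s)
      (1 + s - Real.exp s) s := by
    intro s
    have h2 := (((hasDerivAt_id s).const_add 1).add (((hasDerivAt_id s).pow 2).div_const 2)).sub
      (Real.hasDerivAt_exp s)
    refine h2.congr_deriv ?_
    simp
  have hm : Antitone (fun s : ℝ => 1 + s + s ^ 2 / 2 - Real.exp s) := by
    refine antitone_of_deriv_nonpos (fun s => (hd s).differentiableAt) fun s => ?_
    rw [(hd s).deriv]
    linarith [Real.add_one_le_exp s]
  have h := hm ht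
  simp at h
  linarith

/-- Truncation from above at level `y`. -/
noncomputable def trunc (y u : ℝ) : ℝ := if u ≤ y then u else 0

lemma measurable_trunc (y : ℝ) : Measurable (trunc y) :=
  Measurable.ite measurableSet_Iic measurable_id measurable_const

lemma exp_trunc_le {q y l u : ℝ} (hq : q < 1) (hy : 0 < y) (hl : 0 ≤ l)
    (hly : l ≤ y ^ (q - 1)) :
    Real.exp (l * trunc y u) ≤ 1 + l * u + l ^ 2 / 2 * (u ^ 2 * Real.exp (|u| ^ q)) := by
  have hE : 1 ≤ Real.exp (|u| ^ q) := Real.one_le_exp (by positivity)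
  have hnn : 0 ≤ l ^ 2 / 2 * (u ^ 2 * Real.exp (|u| ^ q)) := by positivity
  unfold trunc
  split_ifs with h
  · rcases le_or_gt u 0 with hu | hu
    · have h1 := exp_le_of_nonpos (mul_nonpos_of_nonneg_of_nonpos hl hu)
      have h2 : (l * u) ^ 2 / 2 ≤ l ^ 2 / 2 * (u ^ 2 * Real.exp (|u| ^ q)) := by
        have : l ^ 2 / 2 * u ^ 2 * 1 ≤ l ^ 2 / 2 * u ^ 2 * Real.exp (|u| ^ q) := by gcongr
        nlinarith
      linarith
    · have h1 := exp_le_of_nonneg (mul_nonneg hl hu.le)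
      have h3 : l * u ≤ |u| ^ q := by
        have h4 : y ^ (q - 1) ≤ u ^ (q - 1) := Real.rpow_le_rpow_of_nonpos hu h (by linarith)
        calc l * u ≤ u ^ (q - 1) * u := by gcongr; linarith
          _ = |u| ^ q := by
            rw [abs_of_pos hu, Real.rpow_sub_one hu.ne']; field_simp
      have h2 : (l * u) ^ 2 / 2 * Real.exp (l * u) ≤
          l ^ 2 / 2 * (u ^ 2 * Real.exp (|u| ^ q)) := by
        have : l ^ 2 / 2 * u ^ 2 * Real.exp (l * u) ≤ l ^ 2 / 2 * u ^ 2 * Real.exp (|u| ^ q) := by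
          gcongr
        nlinarith
      linarith
  · simp only [mul_zero, Real.exp_zero]
    have : 0 ≤ l * u := mul_nonneg hl (by linarith)
    linarith

lemma sq_mul_exp_le {q a b g u : ℝ} (hq0 : 0 < q) (hq1 : q < 1) (_ : 0 ≤ a) (ha1 : a ≤ 1)
    (_ : 0 ≤ b) (hb1 : b ≤ 1) (hg : 0 ≤ g) (hu : |u| ≤ a * g + b) :
    u ^ 2 * Real.exp (|u| ^ q) ≤
      2 * Real.exp 1 * (a ^ 2 * (g ^ 2 * Real.exp (g ^ q)) + b ^ 2 * Real.exp (g ^ q)) := by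
  have h1 : u ^ 2 ≤ 2 * (a ^ 2 * g ^ 2 + b ^ 2) := by
    have : u ^ 2 ≤ (a * g + b) ^ 2 := by
      rw [← sq_abs u]; gcongr
    nlinarith [sq_nonneg (a * g - b)]
  have h2 : |u| ^ q ≤ 1 + g ^ q := by
    calc |u| ^ q ≤ (g + 1) ^ q := by
          gcongr; nlinarith
      _ ≤ g ^ q + 1 ^ q := Real.rpow_add_le_add_rpow hg zero_le_one hq0.le hq1.le
      _ = 1 + g ^ q := by rw [Real.one_rpow]; ring
  calc u ^ 2 * Real.exp (|u| ^ q) ≤ 2 * (a ^ 2 * g ^ 2 + b ^ 2) * Real.exp (1 + g ^ q) := by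
        gcongr
    _ = _ := by rw [Real.exp_add]; ring

/-- The optimisation of the exponential bound. -/
lemma exp_optimize {q y s : ℝ} (hy : 0 < y) (hs : 0 ≤ s) :
    ∃ l : ℝ, 0 ≤ l ∧ l ≤ y ^ (q - 1) ∧
      -(l * y) + l ^ 2 / 2 * s ≤ -(y ^ 2 / (2 * (s + y ^ (2 - q)))) := by
  have hp : 0 < y ^ (2 - q) := Real.rpow_pos_of_pos hy _
  refine ⟨y / (s + y ^ (2 - q)), by positivity, ?_, ?_⟩
  · rw [div_le_iff₀ (by positivity)]
    have : y ^ (q - 1) * y ^ (2 - q) = y := by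
      rw [← Real.rpow_add hy]; norm_num
    have h3 : 0 ≤ y ^ (q - 1) * s := by positivity
    nlinarith
  · have h : 0 < s + y ^ (2 - q) := by positivity
    rw [← sub_nonneg]
    have : -(y ^ 2 / (2 * (s + y ^ (2 - q)))) -
        (-(y / (s + y ^ (2 - q)) * y) + (y / (s + y ^ (2 - q))) ^ 2 / 2 * s) =
        y ^ 2 * y ^ (2 - q) / (2 * (s + y ^ (2 - q)) ^ 2) := by
      field_simp
      ring
    rw [this]
    positivity

lemma exp_neg_rpow_le {q y s : ℝ} (hy : 0 < y) (hs : 0 ≤ s) (hsy : s ≤ y ^ 2) :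
    s / (y ^ 2 * Real.exp (y ^ q)) ≤ Real.exp (-(y ^ 2 / (2 * (s + y ^ (2 - q))))) := by
  have hp : 0 < y ^ (2 - q) := Real.rpow_pos_of_pos hy _
  have h1 : y ^ 2 / (2 * (s + y ^ (2 - q))) ≤ y ^ q := by
    rw [div_le_iff₀ (by positivity)]
    have : y ^ q * y ^ (2 - q) = y ^ 2 := by
      rw [← Real.rpow_add hy, ← Real.rpow_natCast]; norm_num
    have h3 : 0 ≤ y ^ q * s := by positivity
    nlinarith
  calc s / (y ^ 2 * Real.exp (y ^ q)) = (s / y ^ 2) * Real.exp (-(y ^ q)) := by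
        rw [Real.exp_neg]; field_simp
    _ ≤ 1 * Real.exp (-(y ^ 2 / (2 * (s + y ^ (2 - q))))) := by
        gcongr
        rw [div_le_one (by positivity)]; exact hsy
    _ = _ := one_mul _

lemma one_le_two_mul_exp {q y s : ℝ} (hy : 0 < y) (hsy : y ^ 2 < s) :
    1 ≤ 2 * Real.exp (-(y ^ 2 / (2 * (s + y ^ (2 - q))))) := by
  have hp : 0 < y ^ (2 - q) := Real.rpow_pos_of_pos hy _
  have hs : 0 < s := lt_trans (by positivity) hsy
  have h1 : y ^ 2 / (2 * (s + y ^ (2 - q))) ≤ 1 / 2 := by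
    rw [div_le_iff₀ (by positivity)]
    linarith
  have := Real.add_one_le_exp (-(y ^ 2 / (2 * (s + y ^ (2 - q)))))
  linarith

end RealAnalysis

section KBound

lemma K_self (ρ : ℕ → ℝ) (n : ℕ) : K ρ n n = 1 := by simp [K]

lemma K_succ (ρ : ℕ → ℝ) {k n : ℕ} (h : k < n) : K ρ k n = 1 + ρ (k + 1) * K ρ (k + 1) n := by
  unfold K
  rw [← Finset.insert_Icc_add_one_left_eq_Icc h.le, Finset.sum_insert (by simp), Finset.mul_sum]
  congr 1
  · simp
  · refine Finset.sum_congr rfl fun j hj => ?_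
    rw [← Finset.insert_Ioc_add_one_left_eq_Ioc (by simp at hj; omega),
      Finset.prod_insert (by simp)]

lemma K_nonneg {ρ : ℕ → ℝ} (hρ : ∀ n, 2 ≤ n → 0 ≤ ρ n) {k : ℕ} (hk : 1 ≤ k) (n : ℕ) :
    0 ≤ K ρ k n :=
  Finset.sum_nonneg fun j _ => Finset.prod_nonneg fun i hi => hρ i (by simp at hi; omega)

lemma one_le_K {ρ : ℕ → ℝ} (hρ : ∀ n, 2 ≤ n → 0 ≤ ρ n) {k n : ℕ} (hk : 1 ≤ k) (hkn : k ≤ n) :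
    1 ≤ K ρ k n := by
  rcases hkn.eq_or_lt with rfl | h
  · rw [K_self]
  · rw [K_succ _ h]
    have := mul_nonneg (hρ (k + 1) (by omega)) (K_nonneg hρ (k := k + 1) (by omega) n)
    linarith

lemma K_le_of_rho_le {ρ : ℕ → ℝ} {r : ℝ} (hr0 : 0 < r) (hr1 : r < 1)
    (hρ0 : ∀ n, 2 ≤ n → 0 ≤ ρ n) (hρ : ∀ n, 2 ≤ n → ρ n ≤ r) {k n : ℕ} (hk : 1 ≤ k)
    (hkn : k ≤ n) : K ρ k n ≤ 1 / (1 - r) := by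
  have h1 : 0 < 1 - r := by linarith
  induction hkn using Nat.decreasingInduction with
  | self => rw [K_self, le_div_iff₀ h1]; linarith
  | of_succ k hkn ih =>
    have ih := ih (by omega)
    rw [K_succ _ hkn]
    calc 1 + ρ (k + 1) * K ρ (k + 1) n ≤ 1 + r * (1 / (1 - r)) := by
          gcongr
          · exact K_nonneg hρ0 (by omega) n
          · exact hρ _ (by omega)
      _ = 1 / (1 - r) := by field_simp; ring

lemma add_one_rpow_le {a α : ℝ} (ha : 0 < a) (h0 : 0 ≤ α) (h1 : α ≤ 1) :
    (a + 1) ^ α ≤ a ^ α + a ^ (α - 1) := by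
  have h : (1 + a⁻¹) ^ α ≤ 1 + α * a⁻¹ :=
    rpow_one_add_le_one_add_mul_self (by have := inv_pos.2 ha; linarith) h0 h1
  have h2 : a + 1 = a * (1 + a⁻¹) := by field_simp
  rw [h2, Real.mul_rpow ha.le (by positivity)]
  calc a ^ α * (1 + a⁻¹) ^ α ≤ a ^ α * (1 + 1 * a⁻¹) := by
        gcongr
        refine h.trans ?_
        gcongr
    _ = a ^ α + a ^ (α - 1) := by
        rw [Real.rpow_sub_one ha.ne']; field_simp

lemma exists_K_le (α r : ℝ) : ∃ C : ℝ, 0 < C ∧ (0 ≤ α → α < 1 → 0 < r → r < 1 →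
    ∀ ρ : ℕ → ℝ, (∀ n, 2 ≤ n → 0 ≤ ρ n) → (∀ n : ℕ, 2 ≤ n → ρ n ≤ 1 - r / (n : ℝ) ^ α) →
    ∀ k n : ℕ, 1 ≤ k → k ≤ n → K ρ k n ≤ C * (k : ℝ) ^ α) := by
  by_cases hc : 0 ≤ α ∧ α < 1 ∧ 0 < r ∧ r < 1
  swap
  · exact ⟨1, one_pos, fun h1 h2 h3 h4 => absurd ⟨h1, h2, h3, h4⟩ hc⟩
  obtain ⟨hα0, hα1, hr0, hr1⟩ := hc
  obtain ⟨M, hM1, hM⟩ : ∃ M : ℝ, 1 ≤ M ∧ M ^ (α - 1) ≤ r / 2 := by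
    have ht : Tendsto (fun M : ℝ => M ^ (-(1 - α))) atTop (nhds 0) :=
      tendsto_rpow_neg_atTop (by linarith)
    have := (ht.eventually (ge_mem_nhds (show (0 : ℝ) < r / 2 by positivity))).and
      (eventually_ge_atTop (1 : ℝ))
    obtain ⟨M, h1, h2⟩ := this.exists
    exact ⟨M, h2, by rwa [neg_sub] at h1⟩
  have key : ∀ ρ : ℕ → ℝ, (∀ n, 2 ≤ n → 0 ≤ ρ n) →
      (∀ n : ℕ, 2 ≤ n → ρ n ≤ 1 - r / (n : ℝ) ^ α) →
      ∀ k n : ℕ, 1 ≤ k → k ≤ n → K ρ k n ≤ 2 / r * ((k : ℝ) + M) ^ α := by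
    intro ρ hρ0 hρ k n hk hkn
    induction hkn using Nat.decreasingInduction with
    | self =>
      rw [K_self]
      have h2 : 1 ≤ ((n : ℝ) + M) ^ α :=
        Real.one_le_rpow (by have : (0 : ℝ) ≤ n := n.cast_nonneg; linarith) hα0
      have h3 : 1 ≤ 2 / r := by rw [le_div_iff₀ hr0]; linarith
      nlinarith
    | of_succ k hkn ih =>
      have ih := ih (by omega)
      rw [K_succ _ hkn]
      have hk0 : (0 : ℝ) < ((k + 1 : ℕ) : ℝ) := by positivity
      have hkM : (0 : ℝ) < (k : ℝ) + M := by positivity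
      have hpos : 0 < ((k + 1 : ℕ) : ℝ) ^ α := Real.rpow_pos_of_pos hk0 _
      have hrho := hρ (k + 1) (by omega)
      have hle : ((k + 1 : ℕ) : ℝ) ^ α ≤ (((k + 1 : ℕ) : ℝ) + M) ^ α := by
        gcongr; linarith
      have hs : (((k + 1 : ℕ) : ℝ) + M) ^ α ≤ ((k : ℝ) + M) ^ α + r / 2 := by
        have h1 := add_one_rpow_le hkM hα0 hα1.le
        have h2 : ((k : ℝ) + M) ^ (α - 1) ≤ M ^ (α - 1) :=
          Real.rpow_le_rpow_of_nonpos (by linarith)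
            (by have : (0 : ℝ) ≤ k := k.cast_nonneg; linarith) (by linarith)
        have h3 : ((k + 1 : ℕ) : ℝ) + M = (k : ℝ) + M + 1 := by push_cast; ring
        rw [h3]; linarith
      set B := (((k + 1 : ℕ) : ℝ) + M) ^ α
      have hB : 0 < B := lt_of_lt_of_le hpos hle
      have h5 : 2 ≤ r / ((k + 1 : ℕ) : ℝ) ^ α * (2 / r * B) := by
        have : r / ((k + 1 : ℕ) : ℝ) ^ α * (2 / r * B) = 2 * (B / ((k + 1 : ℕ) : ℝ) ^ α) := by
          field_simp
        rw [this]
        have : 1 ≤ B / ((k + 1 : ℕ) : ℝ) ^ α := by rwa [one_le_div hpos]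
        linarith
      calc 1 + ρ (k + 1) * K ρ (k + 1) n ≤ 1 + ρ (k + 1) * (2 / r * B) := by
            gcongr; exact hρ0 _ (by omega)
        _ ≤ 1 + (1 - r / ((k + 1 : ℕ) : ℝ) ^ α) * (2 / r * B) := by gcongr
        _ ≤ 2 / r * B - 1 := by linarith
        _ ≤ 2 / r * (((k : ℝ) + M) ^ α + r / 2) - 1 := by gcongr
        _ = 2 / r * ((k : ℝ) + M) ^ α := by field_simp; ring
  refine ⟨2 / r * (1 + M) ^ α, by positivity, fun _ _ _ _ ρ hρ0 hρ k n hk hkn => ?_⟩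
  refine (key ρ hρ0 hρ k n hk hkn).trans ?_
  have hk1 : (1 : ℝ) ≤ k := by exact_mod_cast hk
  rw [mul_assoc, ← Real.mul_rpow (by positivity) (by positivity)]
  gcongr
  nlinarith

end KBound


section MeanDist

variable {E : Type u} [MetricSpace E] [MeasurableSpace E] [BorelSpace E]
  [SecondCountableTopology E] {P : Measure E}

lemma measurable_meanDist [SFinite P] : Measurable (meanDist P) :=
  Measurable.lintegral_prod_right' (f := fun z : E × E => edist z.1 z.2) measurable_edist

lemma meanDist_ne_top [IsProbabilityMeasure P] {x : E} (hx : meanDist P x ≠ ∞) (y : E) :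
    meanDist P y ≠ ∞ := by
  refine ne_top_of_le_ne_top (ENNReal.add_ne_top.2 ⟨edist_ne_top y x, hx⟩) ?_
  calc meanDist P y ≤ ∫⁻ x', (edist y x + edist x x') ∂P :=
        lintegral_mono fun x' => edist_triangle _ _ _
    _ = edist y x + meanDist P x := by
        rw [lintegral_add_left measurable_const]; simp [meanDist]

lemma integrable_dist {x : E} (hx : meanDist P x ≠ ∞) : Integrable (fun y => dist x y) P := by
  refine ⟨(measurable_const.dist measurable_id).aestronglyMeasurable, ?_⟩
  rw [hasFiniteIntegral_iff_ofReal (ae_of_all _ fun _ => dist_nonneg)]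
  simp only [← edist_dist]
  exact lt_top_iff_ne_top.2 hx

lemma integral_dist_eq (x : E) : ∫ y, dist x y ∂P = (meanDist P x).toReal := by
  rw [integral_eq_lintegral_of_nonneg_ae (ae_of_all _ fun _ => dist_nonneg)
    (show Measurable fun y => dist x y from
      measurable_const.dist measurable_id).aestronglyMeasurable]
  simp only [← edist_dist]
  rfl

end MeanDist

section Independence

lemma indepFun_prodMk_left {Ω α β γ : Type*} [MeasurableSpace Ω] [MeasurableSpace α]
    [MeasurableSpace β] [MeasurableSpace γ] {μ : Measure Ω} [IsProbabilityMeasure μ]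
    {A : Ω → α} {B : Ω → β} {C : Ω → γ} (hA : Measurable A) (hB : Measurable B)
    (hC : Measurable C) (h : IndepFun A (fun ω => (B ω, C ω)) μ) (hBC : IndepFun B C μ) :
    IndepFun (fun ω => (A ω, B ω)) C μ := by
  have hAB : IndepFun A B μ := h.comp measurable_id measurable_fst
  rw [indepFun_iff_map_prod_eq_prod_map_map (by fun_prop) (by fun_prop)] at h hBC hAB ⊢
  have h1 : μ.map (fun ω => ((A ω, B ω), C ω)) =
      (μ.map (fun ω => (A ω, (B ω, C ω)))).map MeasurableEquiv.prodAssoc.symm := by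
    rw [Measure.map_map (MeasurableEquiv.measurable _) (by fun_prop)]
    rfl
  rw [h1, h, hBC, ← Measure.prodAssoc_prod, Measure.map_map (MeasurableEquiv.measurable _)
    (MeasurableEquiv.measurable _), MeasurableEquiv.symm_comp_self, Measure.map_id, hAB]

end Independence

section History

variable {Ω : Type w} {𝒳 : Type u} {𝒴 : Type v} {X : ℕ → Ω → 𝒳}

/-- The path up to time `m`, continued by the initial state. -/
def hist (X : ℕ → Ω → 𝒳) (m : ℕ) (ω : Ω) : ℕ → 𝒳 :=
  fun i => X (if 1 ≤ i ∧ i ≤ m then i else 1) ω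

lemma hist_apply {m i : ℕ} (h1 : 1 ≤ i) (hm : i ≤ m) (ω : Ω) : hist X m ω i = X i ω := by
  simp [hist, h1, hm]

lemma measurable_state [MeasurableSpace Ω] [MeasurableSpace 𝒳] [MeasurableSpace 𝒴]
    {ε : ℕ → Ω → 𝒴} {F : ℕ → 𝒳 → 𝒴 → 𝒳} {m : ℕ}
    (hF : ∀ n, 2 ≤ n → Measurable (fun z : 𝒳 × 𝒴 => F n z.1 z.2))
    (hX : ∀ n, 2 ≤ n → ∀ ω, X n ω = F n (X (n - 1) ω) (ε n ω))
    (h1 : Measurable (X 1)) (hε : ∀ i, 2 ≤ i → i ≤ m → Measurable (ε i)) :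
    ∀ k, 1 ≤ k → k ≤ m → Measurable (X k) := by
  intro k hk
  induction k, hk using Nat.le_induction with
  | base => exact fun _ => h1
  | succ k hk ih =>
    intro hkm
    have : X (k + 1) = (fun z : 𝒳 × 𝒴 => F (k + 1) z.1 z.2) ∘ fun ω => (X k ω, ε (k + 1) ω) := by
      ext ω
      simpa using hX (k + 1) (by omega) ω
    rw [this]
    exact (hF (k + 1) (by omega)).comp ((ih (by omega)).prodMk (hε (k + 1) (by omega) hkm))

lemma measurable_hist [MeasurableSpace Ω] [MeasurableSpace 𝒳] [MeasurableSpace 𝒴]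
    {ε : ℕ → Ω → 𝒴} {F : ℕ → 𝒳 → 𝒴 → 𝒳} {m : ℕ}
    (hF : ∀ n, 2 ≤ n → Measurable (fun z : 𝒳 × 𝒴 => F n z.1 z.2))
    (hX : ∀ n, 2 ≤ n → ∀ ω, X n ω = F n (X (n - 1) ω) (ε n ω)) (hm : 1 ≤ m)
    (h1 : Measurable (X 1)) (hε : ∀ i, 2 ≤ i → i ≤ m → Measurable (ε i)) :
    Measurable (hist X m) := by
  refine measurable_pi_lambda _ fun i => ?_
  refine measurable_state hF hX h1 hε _ ?_ ?_ <;> split_ifs <;> omega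

end History

section Chain

variable {Ω : Type w} {𝒳 : Type u} {𝒴 : Type v} [MeasurableSpace Ω]
  [MetricSpace 𝒳] [MeasurableSpace 𝒳] [MetricSpace 𝒴] [MeasurableSpace 𝒴]
  {μ : Measure Ω} {Pε : Measure 𝒴} {ε : ℕ → Ω → 𝒴} {X : ℕ → Ω → 𝒳}
  {F : ℕ → 𝒳 → 𝒴 → 𝒳} {ρ τ ξ : ℕ → ℝ}

lemma IsChain.isProbabilityMeasure [IsProbabilityMeasure μ] (hC : IsChain μ Pε ε X F ρ τ ξ) :
    IsProbabilityMeasure Pε := by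
  rw [← hC.law_noise 1 le_rfl]
  exact Measure.isProbabilityMeasure_map (hC.measurable_noise 1 le_rfl).aemeasurable

lemma IsChain.measurable_hist (hC : IsChain μ Pε ε X F ρ τ ξ) {m : ℕ} (hm : 1 ≤ m) :
    Measurable (hist X m) :=
  IteratedRandom.measurable_hist hC.measurable_map hC.recursion hm hC.measurable_init
    fun i hi _ => hC.measurable_noise i (by omega)

lemma IsChain.indepFun_hist [IsProbabilityMeasure μ] (hC : IsChain μ Pε ε X F ρ τ ξ) {m : ℕ}
    (hm : 1 ≤ m) : IndepFun (hist X m) (ε (m + 1)) μ := by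
  set B : Ω → (Finset.Icc 1 (m - 1) → 𝒴) := fun ω i => ε (i + 1) ω with hB
  have hBm : Measurable B := measurable_pi_lambda _ fun i => hC.measurable_noise _ (by omega)
  have hεm : Measurable (ε (m + 1)) := hC.measurable_noise _ (by omega)
  have hBC : IndepFun B (ε (m + 1)) μ := by
    have h := hC.indep_noise.indepFun_finset (Finset.Icc 1 (m - 1)) {m}
      (by simp; omega) (fun i => hC.measurable_noise _ (by omega))
    have hmem : m ∈ ({m} : Finset ℕ) := by simp
    have hev : Measurable fun z : ({m} : Finset ℕ) → 𝒴 => z ⟨m, hmem⟩ := measurable_pi_apply _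
    exact h.comp measurable_id hev
  have hABC : IndepFun (X 1) (fun ω => (B ω, ε (m + 1) ω)) μ := by
    have h := hC.indep_init.comp (φ := id)
      (ψ := fun z : ℕ → 𝒴 => ((fun i : Finset.Icc 1 (m - 1) => z (i - 1)), z (m - 1)))
      measurable_id (by fun_prop)
    have e : (fun ω => (B ω, ε (m + 1) ω)) =
        (fun z : ℕ → 𝒴 => ((fun i : Finset.Icc 1 (m - 1) => z (i - 1)), z (m - 1))) ∘
          fun ω (i : ℕ) => ε (i + 2) ω := by
      funext ω
      simp only [hB, Function.comp_apply, Prod.mk.injEq]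
      refine ⟨?_, by congr 1; omega⟩
      funext i
      have := (Finset.mem_Icc.1 i.2).1
      congr 1
      omega
    rw [e]
    exact h
  have h := indepFun_prodMk_left hC.measurable_init hBm hεm hABC hBC
  have hle : MeasurableSpace.comap (hist X m) inferInstance ≤
      MeasurableSpace.comap (fun ω => (X 1 ω, B ω)) inferInstance := by
    rw [← measurable_iff_comap_le]
    have hW : Measurable[MeasurableSpace.comap (fun ω => (X 1 ω, B ω)) inferInstance]
        (fun ω => (X 1 ω, B ω)) := comap_measurable _
    refine @IteratedRandom.measurable_hist _ _ _ _ (MeasurableSpace.comap _ _) _ _ ε F m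
      hC.measurable_map hC.recursion hm (measurable_fst.comp hW) fun i hi him => ?_
    have h2 : Measurable fun z : 𝒳 × (Finset.Icc 1 (m - 1) → 𝒴) =>
        z.2 ⟨i - 1, by simp; omega⟩ := (measurable_pi_apply _).comp measurable_snd
    have h3 := h2.comp hW
    convert h3 using 1
    ext ω
    simp only [hB, Function.comp_apply]
    congr 1
    omega
  rw [IndepFun_iff_Indep] at h ⊢
  exact indep_of_indep_of_le_left h hle

lemma IsChain.map_hist_noise [IsProbabilityMeasure μ] (hC : IsChain μ Pε ε X F ρ τ ξ) {m : ℕ}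
    (hm : 1 ≤ m) :
    μ.map (fun ω => (hist X m ω, ε (m + 1) ω)) = (μ.map (hist X m)).prod Pε := by
  rw [(indepFun_iff_map_prod_eq_prod_map_map (hC.measurable_hist hm).aemeasurable
    (hC.measurable_noise (m + 1) (by omega)).aemeasurable).1 (hC.indepFun_hist hm),
    hC.law_noise _ (by omega)]

/-- Lipschitz functions of a path that depend on the coordinates `1, …, k` only, with
constant `1` for the coordinates before `k` and `L` for the coordinate `k`. -/
def PathLip (k : ℕ) (L : ℝ) (g : (ℕ → 𝒳) → ℝ) : Prop :=
  ∀ h h' : ℕ → 𝒳, |g h - g h'| ≤ ∑ i ∈ Finset.Ico 1 k, dist (h i) (h' i) + L * dist (h k) (h' k)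

lemma PathLip.eq_of_eqOn {k : ℕ} {L : ℝ} {g : (ℕ → 𝒳) → ℝ} (hg : PathLip k L g) (hk : 1 ≤ k)
    {h h' : ℕ → 𝒳} (hh : ∀ i, 1 ≤ i → i ≤ k → h i = h' i) : g h = g h' := by
  have h1 := hg h h'
  rw [Finset.sum_eq_zero, hh k hk le_rfl, dist_self, mul_zero, add_zero] at h1
  · exact sub_eq_zero.1 (abs_nonpos_iff.1 h1)
  · intro i hi
    rw [Finset.mem_Ico] at hi
    rw [hh i hi.1 hi.2.le, dist_self]

lemma PathLip.continuous {k : ℕ} {L : ℝ} {g : (ℕ → 𝒳) → ℝ} (hg : PathLip k L g) :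
    Continuous g := by
  rw [continuous_iff_continuousAt]
  intro h
  rw [ContinuousAt, tendsto_iff_dist_tendsto_zero]
  refine squeeze_zero (fun _ => dist_nonneg) (fun h' => hg h' h) ?_
  have : Continuous fun h' : ℕ → 𝒳 =>
      ∑ i ∈ Finset.Ico 1 k, dist (h' i) (h i) + L * dist (h' k) (h k) := by fun_prop
  have h2 := this.tendsto h
  simpa using h2

/-- One step of backward averaging: the expectation over the state at time `k + 1`. -/
noncomputable def backStep (F : ℕ → 𝒳 → 𝒴 → 𝒳) (P : Measure 𝒴) (k : ℕ) (g : (ℕ → 𝒳) → ℝ)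
    (h : ℕ → 𝒳) : ℝ :=
  ∫ y, g (Function.update h (k + 1) (F (k + 1) (h k) y)) ∂P

/-- `condMean F P n ψ j` is the conditional mean of `ψ` given the path up to time `n - j`. -/
noncomputable def condMean (F : ℕ → 𝒳 → 𝒴 → 𝒳) (P : Measure 𝒴) (n : ℕ) (ψ : (ℕ → 𝒳) → ℝ) :
    ℕ → (ℕ → 𝒳) → ℝ
  | 0 => ψ
  | j + 1 => backStep F P (n - (j + 1)) (condMean F P n ψ j)

lemma condMean_sub {n k : ℕ} (hk : k < n) (ψ : (ℕ → 𝒳) → ℝ) :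
    condMean F Pε n ψ (n - k) = backStep F Pε k (condMean F Pε n ψ (n - (k + 1))) := by
  obtain ⟨j, rfl⟩ : ∃ j, n = k + 1 + j := ⟨n - (k + 1), by omega⟩
  have h1 : k + 1 + j - k = j + 1 := by omega
  have h2 : k + 1 + j - (k + 1) = j := by omega
  rw [h1, h2, condMean]
  congr 1
  omega

lemma condMean_neg (n : ℕ) (ψ : (ℕ → 𝒳) → ℝ) (j : ℕ) :
    condMean F Pε n (fun h => -ψ h) j = fun h => -condMean F Pε n ψ j h := by
  induction j with
  | zero => rfl
  | succ j ih =>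
    rw [condMean, ih]
    ext h
    simp only [backStep, condMean, integral_neg]

variable [BorelSpace 𝒳] [SecondCountableTopology 𝒳] [BorelSpace 𝒴] [SecondCountableTopology 𝒴]

lemma PathLip.measurable {k : ℕ} {L : ℝ} {g : (ℕ → 𝒳) → ℝ} (hg : PathLip k L g) :
    Measurable g := hg.continuous.measurable

lemma PathLip.abs_update_sub_le {k : ℕ} {L : ℝ} {g : (ℕ → 𝒳) → ℝ} (hg : PathLip k L g)
    (h : ℕ → 𝒳) (a b : 𝒳) :
    |g (Function.update h k a) - g (Function.update h k b)| ≤ L * dist a b := by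
  refine (hg _ _).trans (le_of_eq ?_)
  rw [Finset.sum_eq_zero]
  · simp
  · intro i hi
    rw [Finset.mem_Ico] at hi
    rw [Function.update_of_ne (by omega), Function.update_of_ne (by omega), dist_self]

lemma IsChain.measurable_step (hC : IsChain μ Pε ε X F ρ τ ξ) {k : ℕ} (hk : 1 ≤ k) :
    Measurable fun z : (ℕ → 𝒳) × 𝒴 =>
      Function.update z.1 (k + 1) (F (k + 1) (z.1 k) z.2) := by
  refine measurable_pi_lambda _ fun i => ?_
  by_cases hi : i = k + 1
  · subst hi
    simp only [Function.update_self]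
    have hz : Measurable fun z : (ℕ → 𝒳) × 𝒴 => (z.1 k, z.2) := by fun_prop
    exact (hC.measurable_map (k + 1) (by omega)).comp hz
  · simp only [Function.update_of_ne hi]
    fun_prop

lemma IsChain.measurable_step_right (hC : IsChain μ Pε ε X F ρ τ ξ) {k : ℕ} (hk : 1 ≤ k)
    (h : ℕ → 𝒳) : Measurable fun y => Function.update h (k + 1) (F (k + 1) (h k) y) :=
  (hC.measurable_step hk).comp (measurable_const.prodMk measurable_id)

lemma IsChain.integrable_step [IsProbabilityMeasure μ] (hC : IsChain μ Pε ε X F ρ τ ξ) {k : ℕ}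
    (hk : 1 ≤ k) (hG : ∀ y, meanDist Pε y ≠ ∞) {L : ℝ} (hL : 0 ≤ L) {g : (ℕ → 𝒳) → ℝ}
    (hg : PathLip (k + 1) L g) (h : ℕ → 𝒳) :
    Integrable (fun y => g (Function.update h (k + 1) (F (k + 1) (h k) y))) Pε := by
  have := hC.isProbabilityMeasure
  obtain ⟨y₀⟩ : Nonempty 𝒴 := nonempty_of_isProbabilityMeasure Pε
  have hm := (hg.measurable.comp (hC.measurable_step_right hk h)).aestronglyMeasurable (μ := Pε)
  set c := g (Function.update h (k + 1) (F (k + 1) (h k) y₀)) with hc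
  have hint : Integrable (fun y => |c| + L * (τ (k + 1) * dist y₀ y + ξ (k + 1))) Pε :=
    (integrable_const _).add
      ((((integrable_dist (hG y₀)).const_mul _).add (integrable_const _)).const_mul _)
  refine hint.mono' hm (ae_of_all _ fun y => ?_)
  have h1 := hg.abs_update_sub_le h (F (k + 1) (h k) y) (F (k + 1) (h k) y₀)
  have h2 := hC.regular (k + 1) (by omega) (h k) y y₀
  rw [dist_comm y y₀] at h2
  rw [← hc] at h1
  have h3 := mul_le_mul_of_nonneg_left h2 hL
  simp only [Real.norm_eq_abs]
  set d := g (Function.update h (k + 1) (F (k + 1) (h k) y))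
  have h4 : |d| ≤ |d - c| + |c| := by simpa using abs_add_le (d - c) c
  linarith

lemma IsChain.pathLip_backStep [IsProbabilityMeasure μ] (hC : IsChain μ Pε ε X F ρ τ ξ) {k : ℕ}
    (hk : 1 ≤ k) (hG : ∀ y, meanDist Pε y ≠ ∞) {L : ℝ} (hL : 0 ≤ L) {g : (ℕ → 𝒳) → ℝ}
    (hg : PathLip (k + 1) L g) : PathLip k (1 + ρ (k + 1) * L) (backStep F Pε k g) := by
  intro h h'
  have := hC.isProbabilityMeasure
  have hρ := hC.rho_nonneg (k + 1) (by omega)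
  have hmF : ∀ x, Measurable (F (k + 1) x) := fun x =>
    (hC.measurable_map (k + 1) (by omega)).comp (measurable_const.prodMk measurable_id)
  have hfin : ENNReal.ofReal (ρ (k + 1)) * edist (h k) (h' k) ≠ ∞ :=
    ENNReal.mul_ne_top ENNReal.ofReal_ne_top (edist_ne_top _ _)
  have hcon := hC.contract (k + 1) (by omega) (h k) (h' k)
  have hmd : Measurable fun y => dist (F (k + 1) (h k) y) (F (k + 1) (h' k) y) :=
    (hmF _).dist (hmF _)
  have hint : Integrable (fun y => dist (F (k + 1) (h k) y) (F (k + 1) (h' k) y)) Pε := by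
    refine ⟨hmd.aestronglyMeasurable, ?_⟩
    rw [hasFiniteIntegral_iff_ofReal (ae_of_all _ fun _ => dist_nonneg)]
    simp only [← edist_dist]
    exact lt_of_le_of_lt hcon hfin.lt_top
  have hle : ∫ y, dist (F (k + 1) (h k) y) (F (k + 1) (h' k) y) ∂Pε ≤
      ρ (k + 1) * dist (h k) (h' k) := by
    rw [integral_eq_lintegral_of_nonneg_ae (ae_of_all _ fun _ => dist_nonneg)
      hmd.aestronglyMeasurable]
    simp only [← edist_dist]
    refine (ENNReal.toReal_mono hfin hcon).trans (le_of_eq ?_)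
    rw [ENNReal.toReal_mul, ENNReal.toReal_ofReal hρ, edist_dist,
      ENNReal.toReal_ofReal dist_nonneg]
  unfold backStep
  rw [← integral_sub (hC.integrable_step hk hG hL hg h) (hC.integrable_step hk hG hL hg h')]
  calc |∫ y, (g (Function.update h (k + 1) (F (k + 1) (h k) y)) -
        g (Function.update h' (k + 1) (F (k + 1) (h' k) y))) ∂Pε|
      ≤ ∫ y, |g (Function.update h (k + 1) (F (k + 1) (h k) y)) -
        g (Function.update h' (k + 1) (F (k + 1) (h' k) y))| ∂Pε := abs_integral_le_integral_abs
    _ ≤ ∫ y, (∑ i ∈ Finset.Ico 1 (k + 1), dist (h i) (h' i) +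
        L * dist (F (k + 1) (h k) y) (F (k + 1) (h' k) y)) ∂Pε := by
      refine integral_mono ((hC.integrable_step hk hG hL hg h).sub
        (hC.integrable_step hk hG hL hg h')).abs
        ((integrable_const _).add (hint.const_mul _)) fun y => ?_
      refine (hg _ _).trans (le_of_eq ?_)
      simp only [Function.update_self]
      congr 1
      refine Finset.sum_congr rfl fun i hi => ?_
      rw [Finset.mem_Ico] at hi
      rw [Function.update_of_ne (by omega), Function.update_of_ne (by omega)]
    _ = ∑ i ∈ Finset.Ico 1 (k + 1), dist (h i) (h' i) +
        L * ∫ y, dist (F (k + 1) (h k) y) (F (k + 1) (h' k) y) ∂Pε := by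
      rw [integral_add (integrable_const _) (hint.const_mul _), integral_const_mul]
      simp
    _ ≤ ∑ i ∈ Finset.Ico 1 (k + 1), dist (h i) (h' i) + L * (ρ (k + 1) * dist (h k) (h' k)) := by
      gcongr
    _ = _ := by
      rw [Finset.sum_Ico_succ_top hk]
      ring

lemma IsChain.abs_sub_backStep_le [IsProbabilityMeasure μ] (hC : IsChain μ Pε ε X F ρ τ ξ)
    {k : ℕ} (hk : 1 ≤ k) (hG : ∀ y, meanDist Pε y ≠ ∞) {L : ℝ} (hL : 0 ≤ L)
    {g : (ℕ → 𝒳) → ℝ} (hg : PathLip (k + 1) L g) (h : ℕ → 𝒳) (y : 𝒴) :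
    |g (Function.update h (k + 1) (F (k + 1) (h k) y)) - backStep F Pε k g h| ≤
      L * τ (k + 1) * (meanDist Pε y).toReal + L * ξ (k + 1) := by
  have := hC.isProbabilityMeasure
  set c := g (Function.update h (k + 1) (F (k + 1) (h k) y)) with hc
  have hi := hC.integrable_step hk hG hL hg h
  have h1 : c - backStep F Pε k g h =
      ∫ y', (c - g (Function.update h (k + 1) (F (k + 1) (h k) y'))) ∂Pε := by
    rw [integral_sub (integrable_const _) hi]
    simp [backStep]
  rw [h1, ← integral_dist_eq, ← integral_const_mul]
  calc |∫ y', (c - g (Function.update h (k + 1) (F (k + 1) (h k) y'))) ∂Pε|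
      ≤ ∫ y', |c - g (Function.update h (k + 1) (F (k + 1) (h k) y'))| ∂Pε :=
        abs_integral_le_integral_abs
    _ ≤ ∫ y', (L * τ (k + 1) * dist y y' + L * ξ (k + 1)) ∂Pε := by
      refine integral_mono ((integrable_const _).sub hi).abs
        (((integrable_dist (hG y)).const_mul _).add (integrable_const _)) fun y' => ?_
      refine (hg.abs_update_sub_le h _ _).trans ?_
      refine (mul_le_mul_of_nonneg_left (hC.regular (k + 1) (by omega) (h k) y y') hL).trans ?_
      exact le_of_eq (by ring)
    _ = _ := by
      rw [integral_add ((integrable_dist (hG y)).const_mul _) (integrable_const _)]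
      simp

lemma IsChain.pathLip_condMean [IsProbabilityMeasure μ] (hC : IsChain μ Pε ε X F ρ τ ξ)
    (hG : ∀ y, meanDist Pε y ≠ ∞) {n : ℕ} {ψ : (ℕ → 𝒳) → ℝ} (hψ : PathLip n 1 ψ) {k : ℕ}
    (hk : 1 ≤ k) (hkn : k ≤ n) : PathLip k (K ρ k n) (condMean F Pε n ψ (n - k)) := by
  induction hkn using Nat.decreasingInduction with
  | self => simpa [condMean, K_self] using hψ
  | of_succ k hkn ih =>
    rw [condMean_sub hkn, K_succ _ hkn]
    exact hC.pathLip_backStep hk hG (K_nonneg hC.rho_nonneg (by omega) n) (ih (by omega))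

end Chain


section Moments

lemma expPow_eq_ofReal {q : ℝ} (hq : 0 ≤ q) {g : ℝ≥0∞} (hg : g ≠ ∞) :
    expPow q g = ENNReal.ofReal (Real.exp (g.toReal ^ q)) := by
  obtain ⟨t, ht, rfl⟩ : ∃ t : ℝ, 0 ≤ t ∧ g = ENNReal.ofReal t :=
    ⟨g.toReal, ENNReal.toReal_nonneg, (ENNReal.ofReal_toReal hg).symm⟩
  rw [ENNReal.toReal_ofReal ht, expPow, ENNReal.ofReal_rpow_of_nonneg ht hq,
    EReal.coe_ennreal_ofReal, max_eq_left (by positivity), EReal.exp_coe]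

lemma expPow_top {q : ℝ} (hq : 0 < q) : expPow q ∞ = ∞ := by
  simp [expPow, ENNReal.top_rpow_of_pos hq]

variable {E : Type v} [MetricSpace E] [MeasurableSpace E] [BorelSpace E]
  [SecondCountableTopology E] {P : Measure E} [IsProbabilityMeasure P] {q A : ℝ}

lemma meanDist_ne_top_of_moment (hq : 0 < q)
    (hA : ∫⁻ y, meanDist P y ^ 2 * expPow q (meanDist P y) ∂P ≤ ENNReal.ofReal A) (y : E) :
    meanDist P y ≠ ∞ := by
  by_contra hy
  have h : ∀ z, meanDist P z = ∞ := fun z => by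
    by_contra hz
    exact meanDist_ne_top hz y hy
  simp only [h, expPow_top hq] at hA
  simp at hA

lemma measurable_toReal_meanDist : Measurable fun y => (meanDist P y).toReal :=
  measurable_meanDist.ennreal_toReal

lemma integrable_sq_mul_exp (hq : 0 < q)
    (hA : ∫⁻ y, meanDist P y ^ 2 * expPow q (meanDist P y) ∂P ≤ ENNReal.ofReal A) :
    Integrable (fun y => (meanDist P y).toReal ^ 2 * Real.exp ((meanDist P y).toReal ^ q)) P ∧
    (0 ≤ A → ∫ y, (meanDist P y).toReal ^ 2 * Real.exp ((meanDist P y).toReal ^ q) ∂P ≤ A) := by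
  have hG := meanDist_ne_top_of_moment hq hA
  have hm : Measurable fun y =>
      (meanDist P y).toReal ^ 2 * Real.exp ((meanDist P y).toReal ^ q) :=
    (measurable_toReal_meanDist.pow_const 2).mul
      (Real.measurable_exp.comp (measurable_toReal_meanDist.pow_const q))
  have heq : ∫⁻ y, ENNReal.ofReal
      ((meanDist P y).toReal ^ 2 * Real.exp ((meanDist P y).toReal ^ q)) ∂P =
      ∫⁻ y, meanDist P y ^ 2 * expPow q (meanDist P y) ∂P := by
    refine lintegral_congr fun y => ?_
    rw [ENNReal.ofReal_mul (by positivity), expPow_eq_ofReal hq.le (hG y),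
      ENNReal.ofReal_pow ENNReal.toReal_nonneg, ENNReal.ofReal_toReal (hG y)]
  refine ⟨⟨hm.aestronglyMeasurable, ?_⟩, fun hA0 => ?_⟩
  · rw [hasFiniteIntegral_iff_ofReal (ae_of_all _ fun y => by positivity), heq]
    exact lt_of_le_of_lt hA ENNReal.ofReal_lt_top
  · rw [integral_eq_lintegral_of_nonneg_ae (ae_of_all _ fun y => by positivity)
      hm.aestronglyMeasurable, heq]
    exact ENNReal.toReal_le_of_le_ofReal hA0 hA

lemma exp_rpow_le_add {q g : ℝ} (hq : 0 < q) (hg : 0 ≤ g) :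
    Real.exp (g ^ q) ≤ Real.exp 1 + g ^ 2 * Real.exp (g ^ q) := by
  rcases le_total g 1 with h | h
  · have : Real.exp (g ^ q) ≤ Real.exp 1 := Real.exp_le_exp.2 (Real.rpow_le_one hg h hq.le)
    have : 0 ≤ g ^ 2 * Real.exp (g ^ q) := by positivity
    linarith
  · have h1 : 1 ≤ g ^ 2 := one_le_pow₀ h
    have := mul_le_mul_of_nonneg_right h1 (Real.exp_pos (g ^ q)).le
    have := Real.exp_pos 1
    linarith

lemma integrable_exp_meanDist (hq : 0 < q)
    (hA : ∫⁻ y, meanDist P y ^ 2 * expPow q (meanDist P y) ∂P ≤ ENNReal.ofReal A) :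
    Integrable (fun y => Real.exp ((meanDist P y).toReal ^ q)) P := by
  refine ((integrable_const (Real.exp 1)).add (integrable_sq_mul_exp hq hA).1).mono'
    (Real.measurable_exp.comp
      (measurable_toReal_meanDist.pow_const q)).aestronglyMeasurable
    (ae_of_all _ fun y => ?_)
  rw [Real.norm_eq_abs, abs_of_pos (Real.exp_pos _)]
  exact exp_rpow_le_add hq ENNReal.toReal_nonneg

lemma integral_exp_meanDist (hq : 0 < q)
    (hA : ∫⁻ y, meanDist P y ^ 2 * expPow q (meanDist P y) ∂P ≤ ENNReal.ofReal A) :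
    ∫ y, Real.exp ((meanDist P y).toReal ^ q) ∂P =
      (∫⁻ y, expPow q (meanDist P y) ∂P).toReal := by
  rw [integral_eq_lintegral_of_nonneg_ae (ae_of_all _ fun y => by positivity)
    (integrable_exp_meanDist hq hA).1]
  congr 1
  exact lintegral_congr fun y =>
    (expPow_eq_ofReal hq.le (meanDist_ne_top_of_moment hq hA y)).symm

lemma lintegral_expPow_le (hq : 0 < q) (hA0 : 0 ≤ A)
    (hA : ∫⁻ y, meanDist P y ^ 2 * expPow q (meanDist P y) ∂P ≤ ENNReal.ofReal A) :
    (∫⁻ y, expPow q (meanDist P y) ∂P).toReal ≤ Real.exp 1 + A := by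
  rw [← integral_exp_meanDist hq hA]
  obtain ⟨h1, h2⟩ := integrable_sq_mul_exp hq hA
  calc ∫ y, Real.exp ((meanDist P y).toReal ^ q) ∂P
      ≤ ∫ y, (Real.exp 1 +
        (meanDist P y).toReal ^ 2 * Real.exp ((meanDist P y).toReal ^ q)) ∂P :=
        integral_mono (integrable_exp_meanDist hq hA) ((integrable_const _).add h1)
          fun y => exp_rpow_le_add hq ENNReal.toReal_nonneg
    _ ≤ Real.exp 1 + A := by
        rw [integral_add (integrable_const _) h1]
        simp only [integral_const, probReal_univ, one_smul]
        linarith [h2 hA0]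

lemma integrable_toReal_meanDist (hq : 0 < q)
    (hA : ∫⁻ y, meanDist P y ^ 2 * expPow q (meanDist P y) ∂P ≤ ENNReal.ofReal A) :
    Integrable (fun y => (meanDist P y).toReal) P := by
  refine ((integrable_const (1 : ℝ)).add (integrable_sq_mul_exp hq hA).1).mono'
    measurable_toReal_meanDist.aestronglyMeasurable (ae_of_all _ fun y => ?_)
  rw [Real.norm_eq_abs, abs_of_nonneg ENNReal.toReal_nonneg]
  simp only [Pi.add_apply]
  set g := (meanDist P y).toReal
  have hg : 0 ≤ g := ENNReal.toReal_nonneg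
  have h1 : 1 ≤ Real.exp (g ^ q) := Real.one_le_exp (by positivity)
  have h2 := mul_le_mul_of_nonneg_left h1 (sq_nonneg g)
  nlinarith [sq_nonneg (g - 1)]

/-- The envelope of `u² exp (|u| ^ q)` for `|u| ≤ a G + b`. -/
noncomputable def envelope (P : Measure E) (q a b : ℝ) (y : E) : ℝ :=
  2 * Real.exp 1 * (a ^ 2 * ((meanDist P y).toReal ^ 2 * Real.exp ((meanDist P y).toReal ^ q)) +
    b ^ 2 * Real.exp ((meanDist P y).toReal ^ q))

lemma envelope_nonneg (a b : ℝ) (y : E) : 0 ≤ envelope P q a b y := by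
  unfold envelope; positivity

lemma integrable_envelope (hq : 0 < q)
    (hA : ∫⁻ y, meanDist P y ^ 2 * expPow q (meanDist P y) ∂P ≤ ENNReal.ofReal A) (a b : ℝ) :
    Integrable (envelope P q a b) P :=
  (((integrable_sq_mul_exp hq hA).1.const_mul _).add
    ((integrable_exp_meanDist hq hA).const_mul _)).const_mul _

lemma integral_envelope_le (hq : 0 < q) (hA0 : 0 ≤ A)
    (hA : ∫⁻ y, meanDist P y ^ 2 * expPow q (meanDist P y) ∂P ≤ ENNReal.ofReal A) (a b : ℝ) :
    ∫ y, envelope P q a b y ∂P ≤ 2 * Real.exp 1 *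
      (a ^ 2 * A + b ^ 2 * (∫⁻ y, expPow q (meanDist P y) ∂P).toReal) := by
  unfold envelope
  rw [integral_const_mul, integral_add ((integrable_sq_mul_exp hq hA).1.const_mul _)
    ((integrable_exp_meanDist hq hA).const_mul _), integral_const_mul, integral_const_mul,
    integral_exp_meanDist hq hA]
  gcongr
  exact (integrable_sq_mul_exp hq hA).2 hA0

end Moments

section OneStep

variable {E : Type v} [MeasurableSpace E] {P : Measure E} [IsProbabilityMeasure P]

lemma lintegral_exp_trunc_le {q y l w : ℝ} (hq : q < 1) (hy : 0 < y) (hl : 0 ≤ l)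
    (hly : l ≤ y ^ (q - 1)) {D U : E → ℝ} (hD : Integrable D P) (hD0 : ∫ z, D z ∂P = 0)
    (hU : Integrable U P) (hDU : ∀ z, D z ^ 2 * Real.exp (|D z| ^ q) ≤ U z)
    (hUw : ∫ z, U z ∂P ≤ w) :
    ∫⁻ z, ENNReal.ofReal (Real.exp (l * trunc y (D z))) ∂P ≤
      ENNReal.ofReal (Real.exp (l ^ 2 / 2 * w)) := by
  have hi : Integrable (fun z => 1 + l * D z + l ^ 2 / 2 * U z) P :=
    ((integrable_const _).add (hD.const_mul _)).add (hU.const_mul _)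
  have hle : ∀ z, Real.exp (l * trunc y (D z)) ≤ 1 + l * D z + l ^ 2 / 2 * U z := fun z => by
    refine (exp_trunc_le hq hy hl hly).trans ?_
    gcongr
    exact hDU z
  calc ∫⁻ z, ENNReal.ofReal (Real.exp (l * trunc y (D z))) ∂P
      ≤ ∫⁻ z, ENNReal.ofReal (1 + l * D z + l ^ 2 / 2 * U z) ∂P :=
        lintegral_mono fun z => ENNReal.ofReal_le_ofReal (hle z)
    _ = ENNReal.ofReal (∫ z, (1 + l * D z + l ^ 2 / 2 * U z) ∂P) :=
        (ofReal_integral_eq_lintegral_ofReal hi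
          (ae_of_all _ fun z => (Real.exp_pos _).le.trans (hle z))).symm
    _ ≤ _ := by
        refine ENNReal.ofReal_le_ofReal ?_
        rw [integral_add (f := fun z => 1 + l * D z)
          ((integrable_const _).add (hD.const_mul _)) (hU.const_mul _),
          integral_add (integrable_const _) (hD.const_mul _), integral_const_mul,
          integral_const_mul, hD0]
        simp only [integral_const, probReal_univ, one_smul, mul_zero, add_zero]
        have h1 := Real.add_one_le_exp (l ^ 2 / 2 * w)
        have h2 : l ^ 2 / 2 * ∫ z, U z ∂P ≤ l ^ 2 / 2 * w := by gcongr
        linarith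

end OneStep

section Concentration

variable {Ω : Type w} {𝒳 : Type u} {𝒴 : Type v} [MeasurableSpace Ω]
  [MetricSpace 𝒳] [MeasurableSpace 𝒳] [MetricSpace 𝒴] [MeasurableSpace 𝒴]
  {μ : Measure Ω} {Pε : Measure 𝒴} {ε : ℕ → Ω → 𝒴} {X : ℕ → Ω → 𝒳}
  {F : ℕ → 𝒳 → 𝒴 → 𝒳} {ρ τ ξ : ℕ → ℝ}
  [BorelSpace 𝒳] [SecondCountableTopology 𝒳] [BorelSpace 𝒴] [SecondCountableTopology 𝒴]

/-- The path of the chain. -/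
def path (X : ℕ → Ω → 𝒳) (ω : Ω) : ℕ → 𝒳 := fun i => X i ω

lemma PathLip.path_eq {k m : ℕ} {L : ℝ} {g : (ℕ → 𝒳) → ℝ} (hg : PathLip k L g) (hk : 1 ≤ k)
    (hkm : k ≤ m) (ω : Ω) : g (path X ω) = g (hist X m ω) :=
  hg.eq_of_eqOn hk fun i hi hik => (hist_apply hi (by omega) ω).symm

lemma IsChain.path_eq_step (hC : IsChain μ Pε ε X F ρ τ ξ) {k : ℕ} {L : ℝ} {g : (ℕ → 𝒳) → ℝ}
    (hg : PathLip (k + 1) L g) (hk : 1 ≤ k) (ω : Ω) :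
    g (path X ω) = g (Function.update (hist X k ω) (k + 1)
      (F (k + 1) (hist X k ω k) (ε (k + 1) ω))) := by
  refine hg.eq_of_eqOn (by omega) fun i hi hik => ?_
  rcases eq_or_ne i (k + 1) with rfl | hne
  · rw [Function.update_self, hist_apply hk le_rfl]
    simpa [path] using hC.recursion (k + 1) (by omega) ω
  · rw [Function.update_of_ne hne, hist_apply hi (by omega)]
    rfl

lemma IsChain.measurable_path_comp (hC : IsChain μ Pε ε X F ρ τ ξ) {k : ℕ} {L : ℝ}
    {g : (ℕ → 𝒳) → ℝ} (hg : PathLip k L g) (hk : 1 ≤ k) : Measurable fun ω => g (path X ω) := by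
  simp only [fun ω => hg.path_eq hk le_rfl (X := X) ω]
  exact hg.measurable.comp (hC.measurable_hist hk)

lemma IsChain.lintegral_hist_noise [IsProbabilityMeasure μ] (hC : IsChain μ Pε ε X F ρ τ ξ)
    {m : ℕ} (hm : 1 ≤ m) {Φ : (ℕ → 𝒳) × 𝒴 → ℝ≥0∞} (hΦ : Measurable Φ) :
    ∫⁻ ω, Φ (hist X m ω, ε (m + 1) ω) ∂μ = ∫⁻ ω, ∫⁻ y, Φ (hist X m ω, y) ∂Pε ∂μ := by
  have := hC.isProbabilityMeasure
  have hh := hC.measurable_hist hm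
  rw [← lintegral_map hΦ (hh.prodMk (hC.measurable_noise (m + 1) (by omega))),
    hC.map_hist_noise hm, lintegral_prod _ hΦ.aemeasurable,
    lintegral_map hΦ.lintegral_prod_right' hh]

/-- Exponential moments of a sum of truncated increments, from the conditional ones. -/
lemma IsChain.lintegral_exp_sum_trunc_le [IsProbabilityMeasure μ]
    (hC : IsChain μ Pε ε X F ρ τ ξ) {g : ℕ → (ℕ → 𝒳) → ℝ} {L : ℕ → ℝ} {n : ℕ}
    (hg : ∀ k, 1 ≤ k → k ≤ n → PathLip k (L k) (g k)) {l z δ : ℝ} {w : ℕ → ℝ}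
    (hstep : ∀ k, 1 ≤ k → k < n → ∀ h, ∫⁻ y, ENNReal.ofReal (Real.exp (l * trunc z
      ((g (k + 1) (Function.update h (k + 1) (F (k + 1) (h k) y)) - g k h) / δ))) ∂Pε ≤
        ENNReal.ofReal (Real.exp (l ^ 2 / 2 * w k))) {m : ℕ} (hm : 1 ≤ m) (hmn : m ≤ n) :
    ∫⁻ ω, ENNReal.ofReal (Real.exp (l * ∑ k ∈ Finset.Ico 1 m,
      trunc z ((g (k + 1) (path X ω) - g k (path X ω)) / δ))) ∂μ ≤
        ENNReal.ofReal (Real.exp (l ^ 2 / 2 * ∑ k ∈ Finset.Ico 1 m, w k)) := by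
  have := hC.isProbabilityMeasure
  induction m, hm using Nat.le_induction with
  | base => simp
  | succ m hm ih =>
    have ih := ih (by omega)
    set A : (ℕ → 𝒳) → ℝ≥0∞ := fun h => ENNReal.ofReal (Real.exp (l * ∑ k ∈ Finset.Ico 1 m,
      trunc z ((g (k + 1) h - g k h) / δ))) with hA
    set B : (ℕ → 𝒳) × 𝒴 → ℝ≥0∞ := fun p => ENNReal.ofReal (Real.exp (l * trunc z
      ((g (m + 1) (Function.update p.1 (m + 1) (F (m + 1) (p.1 m) p.2)) - g m p.1) / δ))) with hB
    have hgm : ∀ k, 1 ≤ k → k ≤ n → Measurable (g k) := fun k h1 h2 => (hg k h1 h2).measurable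
    have hAm : Measurable A := by
      refine (Real.measurable_exp.comp (measurable_const.mul
        (Finset.measurable_fun_sum _ fun k hk => ?_))).ennreal_ofReal
      rw [Finset.mem_Ico] at hk
      exact (measurable_trunc z).comp (((hgm (k + 1) (by omega) (by omega)).sub
        (hgm k (by omega) (by omega))).div_const δ)
    have hBm : Measurable B := by
      refine (Real.measurable_exp.comp (measurable_const.mul
        ((measurable_trunc z).comp (Measurable.div_const (Measurable.sub ?_ ?_) δ)))).ennreal_ofReal
      · exact (hgm (m + 1) (by omega) hmn).comp (hC.measurable_step hm)
      · exact (hgm m hm (by omega)).comp measurable_fst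
    have hAX : ∀ ω, A (path X ω) = A (hist X m ω) := by
      intro ω
      simp only [hA]
      congr 3
      refine Finset.sum_congr rfl fun k hk => ?_
      rw [Finset.mem_Ico] at hk
      rw [(hg (k + 1) (by omega) (by omega)).path_eq (by omega) (show k + 1 ≤ m by omega),
        (hg k hk.1 (by omega)).path_eq hk.1 (show k ≤ m by omega)]
    have hsplit : ∀ ω, ENNReal.ofReal (Real.exp (l * ∑ k ∈ Finset.Ico 1 (m + 1),
        trunc z ((g (k + 1) (path X ω) - g k (path X ω)) / δ))) =
        A (hist X m ω) * B (hist X m ω, ε (m + 1) ω) := by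
      intro ω
      rw [← hAX, Finset.sum_Ico_succ_top hm, mul_add, Real.exp_add,
        ENNReal.ofReal_mul (Real.exp_pos _).le]
      simp only [hA, hB]
      rw [hC.path_eq_step (hg (m + 1) (by omega) hmn) hm ω,
        (hg m hm (by omega)).path_eq hm le_rfl (X := X) ω]
    simp only [hsplit]
    rw [hC.lintegral_hist_noise hm (Φ := fun p => A p.1 * B p)
      ((hAm.comp measurable_fst).mul hBm)]
    calc ∫⁻ ω, ∫⁻ y, A (hist X m ω) * B (hist X m ω, y) ∂Pε ∂μ
        ≤ ∫⁻ ω, A (hist X m ω) * ENNReal.ofReal (Real.exp (l ^ 2 / 2 * w m)) ∂μ := by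
          refine lintegral_mono fun ω => ?_
          rw [lintegral_const_mul _ (f := fun y => B (hist X m ω, y))
            (hBm.comp (measurable_const.prodMk measurable_id))]
          gcongr
          exact hstep m hm (by omega) _
      _ = (∫⁻ ω, A (path X ω) ∂μ) * ENNReal.ofReal (Real.exp (l ^ 2 / 2 * w m)) := by
          simp only [hAX]
          rw [lintegral_mul_const _ (f := fun ω => A (hist X m ω)) (hAm.comp (hC.measurable_hist hm))]
      _ ≤ ENNReal.ofReal (Real.exp (l ^ 2 / 2 * ∑ k ∈ Finset.Ico 1 m, w k)) *
          ENNReal.ofReal (Real.exp (l ^ 2 / 2 * w m)) := by gcongr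
      _ = _ := by
          rw [← ENNReal.ofReal_mul (Real.exp_pos _).le, ← Real.exp_add,
            Finset.sum_Ico_succ_top hm, mul_add]

variable {q A₁ : ℝ}

/-- One-sided deviation of a path functional from its conditional mean given `X 1`. -/
theorem IsChain.measure_sub_condMean_ge_le [IsProbabilityMeasure μ]
    (hC : IsChain μ Pε ε X F ρ τ ξ) (hq0 : 0 < q) (hq1 : q < 1) (hA0 : 0 ≤ A₁)
    (hA : ∫⁻ y, meanDist Pε y ^ 2 * expPow q (meanDist Pε y) ∂Pε ≤ ENNReal.ofReal A₁)
    {n : ℕ} (hn : 1 ≤ n) {ψ : (ℕ → 𝒳) → ℝ} (hψ : PathLip n 1 ψ) {δ W y : ℝ} (hδ : 0 < δ)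
    (hτ : ∀ k, 2 ≤ k → k ≤ n → K ρ k n * τ k ≤ δ) (hξ : ∀ k, 2 ≤ k → k ≤ n → K ρ k n * ξ k ≤ δ)
    (hW : Vsq Pε ρ τ ξ q A₁ n ≤ W) (hy : 0 < y) :
    μ {ω | y ≤ ψ (path X ω) - condMean F Pε n ψ (n - 1) (path X ω)} ≤
      ENNReal.ofReal (2 * Real.exp (-(y ^ 2 / (2 * (W + y ^ (2 - q) * δ ^ q))))) := by
  have hP := hC.isProbabilityMeasure
  have hG := meanDist_ne_top_of_moment hq0 hA
  set z := y / δ with hz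
  set s := W / δ ^ 2 with hs
  have hz0 : 0 < z := div_pos hy hδ
  have hexp : y ^ 2 / (2 * (W + y ^ (2 - q) * δ ^ q)) = z ^ 2 / (2 * (s + z ^ (2 - q))) := by
    have h1 : z ^ (2 - q) = y ^ (2 - q) * δ ^ q / δ ^ 2 := by
      rw [hz, Real.div_rpow hy.le hδ.le, Real.rpow_sub hδ, ← Real.rpow_natCast δ 2]
      field_simp
      norm_num
    rw [h1, hs, hz]
    field_simp
  rw [hexp]
  set M₀ := (∫⁻ y, expPow q (meanDist Pε y) ∂Pε).toReal with hM₀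
  set a : ℕ → ℝ := fun k => K ρ (k + 1) n * τ (k + 1) / δ with ha
  set b : ℕ → ℝ := fun k => K ρ (k + 1) n * ξ (k + 1) / δ with hb
  set w : ℕ → ℝ := fun k => 2 * Real.exp 1 * (a k ^ 2 * A₁ + b k ^ 2 * M₀) with hw
  have hws : ∑ k ∈ Finset.Ico 1 n, w k ≤ s := by
    have : ∑ k ∈ Finset.Ico 1 n, w k = Vsq Pε ρ τ ξ q A₁ n / δ ^ 2 := by
      rw [Vsq, ← Finset.Ico_add_one_right_eq_Icc, ← Finset.sum_Ico_add' _ 1 n 1, Finset.mul_sum,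
        Finset.sum_div]
      refine Finset.sum_congr rfl fun k _ => ?_
      simp only [hw, ha, hb, ← hM₀]
      field_simp
    rw [this, hs]
    gcongr
  have hM₀_nonneg : 0 ≤ M₀ := ENNReal.toReal_nonneg
  have hw0 : ∀ k, 0 ≤ w k := fun k => by simp only [hw]; positivity
  have hs0 : 0 ≤ s := (Finset.sum_nonneg fun k _ => hw0 k).trans hws
  rcases lt_or_ge (z ^ 2) s with hzs | hzs
  · refine prob_le_one.trans ?_
    rw [← ENNReal.ofReal_one]
    exact ENNReal.ofReal_le_ofReal (one_le_two_mul_exp hz0 hzs)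
  set g : ℕ → (ℕ → 𝒳) → ℝ := fun k => condMean F Pε n ψ (n - k) with hg_def
  have hg : ∀ k, 1 ≤ k → k ≤ n → PathLip k (K ρ k n) (g k) := fun k h1 h2 =>
    hC.pathLip_condMean hG hψ h1 h2
  have hgstep : ∀ k, k < n → g k = backStep F Pε k (g (k + 1)) := fun k h2 => condMean_sub h2 ψ
  have hK0 : ∀ k, 0 ≤ K ρ (k + 1) n := fun k => K_nonneg hC.rho_nonneg (by omega) n
  have hincr : ∀ k, 1 ≤ k → k < n → ∀ h y,
      |(g (k + 1) (Function.update h (k + 1) (F (k + 1) (h k) y)) - g k h) / δ| ≤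
        a k * (meanDist Pε y).toReal + b k := by
    intro k h1 h2 h y
    rw [hgstep k h2, abs_div, abs_of_pos hδ, div_le_iff₀ hδ]
    refine (hC.abs_sub_backStep_le h1 hG (hK0 k) (hg (k + 1) (by omega) (by omega)) h y).trans
      (le_of_eq ?_)
    simp only [ha, hb]
    field_simp
  have ha0 : ∀ k, 1 ≤ k → 0 ≤ a k := fun k h1 =>
    div_nonneg (mul_nonneg (hK0 k) (hC.tau_nonneg _ (by omega))) hδ.le
  have hb0 : ∀ k, 1 ≤ k → 0 ≤ b k := fun k h1 =>
    div_nonneg (mul_nonneg (hK0 k) (hC.xi_nonneg _ (by omega))) hδ.le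
  have ha1 : ∀ k, 1 ≤ k → k < n → a k ≤ 1 := fun k h1 h2 =>
    (div_le_one hδ).2 (hτ _ (by omega) (by omega))
  have hb1 : ∀ k, 1 ≤ k → k < n → b k ≤ 1 := fun k h1 h2 =>
    (div_le_one hδ).2 (hξ _ (by omega) (by omega))
  have henv : ∀ k, 1 ≤ k → k < n → ∀ h y,
      ((g (k + 1) (Function.update h (k + 1) (F (k + 1) (h k) y)) - g k h) / δ) ^ 2 *
        Real.exp (|(g (k + 1) (Function.update h (k + 1) (F (k + 1) (h k) y)) - g k h) / δ| ^ q)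
        ≤ envelope Pε q (a k) (b k) y := fun k h1 h2 h y =>
    sq_mul_exp_le hq0 hq1 (ha0 k h1) (ha1 k h1 h2) (hb0 k h1) (hb1 k h1 h2)
      ENNReal.toReal_nonneg (hincr k h1 h2 h y)
  have hUw : ∀ k, ∫ y, envelope Pε q (a k) (b k) y ∂Pε ≤ w k := fun k =>
    integral_envelope_le hq0 hA0 hA _ _
  obtain ⟨l, hl0, hly, hlopt⟩ := exp_optimize (q := q) hz0 hs0
  set R := -(z ^ 2 / (2 * (s + z ^ (2 - q)))) with hR
  -- the truncated sum
  have hmgf := hC.lintegral_exp_sum_trunc_le (w := w) (l := l) (z := z) (δ := δ) hg (by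
    intro k h1 h2 h
    have hint := hC.integrable_step h1 hG (hK0 k) (hg (k + 1) (by omega) (by omega)) h
    refine lintegral_exp_trunc_le hq1 hz0 hl0 hly ((hint.sub (integrable_const _)).div_const _)
      ?_ (integrable_envelope hq0 hA (a k) (b k)) (henv k h1 h2 h) (hUw k)
    rw [integral_div, integral_sub hint (integrable_const _), hgstep k h2]
    simp [backStep]) hn le_rfl
  have hT : μ {ω | z ≤ ∑ k ∈ Finset.Ico 1 n,
      trunc z ((g (k + 1) (path X ω) - g k (path X ω)) / δ)} ≤ ENNReal.ofReal (Real.exp R) := by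
    have hSm : Measurable fun ω => ENNReal.ofReal (Real.exp (l * ∑ k ∈ Finset.Ico 1 n,
        trunc z ((g (k + 1) (path X ω) - g k (path X ω)) / δ))) := by
      refine (Real.measurable_exp.comp (measurable_const.mul
        (Finset.measurable_fun_sum _ fun k hk => ?_))).ennreal_ofReal
      rw [Finset.mem_Ico] at hk
      exact (measurable_trunc z).comp
        (((hC.measurable_path_comp (hg (k + 1) (by omega) (by omega)) (by omega)).sub
        (hC.measurable_path_comp (hg k (by omega) (by omega)) (by omega))).div_const δ)
    have hsub : {ω | z ≤ ∑ k ∈ Finset.Ico 1 n,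
        trunc z ((g (k + 1) (path X ω) - g k (path X ω)) / δ)} ⊆
        {ω | ENNReal.ofReal (Real.exp (l * z)) ≤ ENNReal.ofReal (Real.exp (l *
          ∑ k ∈ Finset.Ico 1 n, trunc z ((g (k + 1) (path X ω) - g k (path X ω)) / δ)))} := by
      intro ω hω
      simp only [Set.mem_ofPred_eq] at hω ⊢
      gcongr
    refine (measure_mono hsub).trans ?_
    refine (meas_ge_le_lintegral_div hSm.aemeasurable
      (by simpa using Real.exp_pos _) ENNReal.ofReal_ne_top).trans ?_
    refine (ENNReal.div_le_div_right hmgf _).trans ?_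
    rw [← ENNReal.ofReal_div_of_pos (Real.exp_pos _), ← Real.exp_sub]
    refine ENNReal.ofReal_le_ofReal (Real.exp_le_exp.2 ?_)
    have : l ^ 2 / 2 * ∑ k ∈ Finset.Ico 1 n, w k ≤ l ^ 2 / 2 * s := by gcongr
    linarith
  -- the maximal increment
  set c := z ^ 2 * Real.exp (z ^ q) with hc
  have hc0 : 0 < c := by positivity
  have hbig : ∀ k, 1 ≤ k → k < n →
      μ {ω | z < (g (k + 1) (path X ω) - g k (path X ω)) / δ} ≤ ENNReal.ofReal (w k / c) := by
    intro k h1 h2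
    have hUm : Measurable (envelope Pε q (a k) (b k)) := by
      have h3 := measurable_toReal_meanDist (P := Pε)
      have h4 := Real.measurable_exp.comp (h3.pow_const q)
      exact measurable_const.mul ((measurable_const.mul ((h3.pow_const 2).mul h4)).add
        (measurable_const.mul h4))
    have hsub : {ω | z < (g (k + 1) (path X ω) - g k (path X ω)) / δ} ⊆
        ε (k + 1) ⁻¹' {y | c ≤ envelope Pε q (a k) (b k) y} := by
      intro ω hω
      simp only [Set.mem_ofPred_eq, Set.mem_preimage] at hω ⊢
      refine le_trans ?_ (henv k h1 h2 (hist X k ω) (ε (k + 1) ω))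
      rw [hC.path_eq_step (hg (k + 1) (by omega) (by omega)) h1 ω,
        (hg k h1 h2.le).path_eq h1 le_rfl ω] at hω
      set D := (g (k + 1) (Function.update (hist X k ω) (k + 1)
        (F (k + 1) (hist X k ω k) (ε (k + 1) ω))) - g k (hist X k ω)) / δ
      have hzD : z ≤ |D| := hω.le.trans (le_abs_self D)
      have : z ≤ D := hω.le
      simp only [hc]
      gcongr
    refine (measure_mono hsub).trans ?_
    rw [← Measure.map_apply (hC.measurable_noise (k + 1) (by omega))
      (measurableSet_le measurable_const hUm), hC.law_noise (k + 1) (by omega),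
      ← ofReal_measureReal]
    refine ENNReal.ofReal_le_ofReal ?_
    rw [le_div_iff₀ hc0, mul_comm]
    exact (mul_meas_ge_le_integral_of_nonneg (ae_of_all _ fun y => envelope_nonneg _ _ y)
      (integrable_envelope hq0 hA _ _) c).trans (hUw k)
  have hsub : {ω | y ≤ ψ (path X ω) - condMean F Pε n ψ (n - 1) (path X ω)} ⊆
      {ω | z ≤ ∑ k ∈ Finset.Ico 1 n,
        trunc z ((g (k + 1) (path X ω) - g k (path X ω)) / δ)} ∪
      ⋃ k ∈ Finset.Ico 1 n, {ω | z < (g (k + 1) (path X ω) - g k (path X ω)) / δ} := by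
    intro ω hω
    by_cases hex : ∃ k ∈ Finset.Ico 1 n, z < (g (k + 1) (path X ω) - g k (path X ω)) / δ
    · right
      obtain ⟨k, hk, hk'⟩ := hex
      exact Set.mem_biUnion hk hk'
    · left
      push Not at hex
      simp only [Set.mem_ofPred_eq] at hω ⊢
      have h1 : ∑ k ∈ Finset.Ico 1 n, trunc z ((g (k + 1) (path X ω) - g k (path X ω)) / δ) =
          (ψ (path X ω) - condMean F Pε n ψ (n - 1) (path X ω)) / δ := by
        have h2 : ∀ k ∈ Finset.Ico 1 n, trunc z ((g (k + 1) (path X ω) - g k (path X ω)) / δ) =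
            (g (k + 1) (path X ω) - g k (path X ω)) / δ := fun k hk => if_pos (hex k hk)
        rw [Finset.sum_congr rfl h2, ← Finset.sum_div,
          Finset.sum_Ico_sub (fun k => g k (path X ω)) hn]
        simp [hg_def, condMean]
      rw [h1, hz]
      gcongr
  refine (measure_mono hsub).trans ((measure_union_le _ _).trans ?_)
  have hU : μ (⋃ k ∈ Finset.Ico 1 n, {ω | z < (g (k + 1) (path X ω) - g k (path X ω)) / δ}) ≤
      ENNReal.ofReal (Real.exp R) := by
    refine (measure_biUnion_finset_le _ _).trans ?_
    refine (Finset.sum_le_sum fun k hk => hbig k (Finset.mem_Ico.1 hk).1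
      (Finset.mem_Ico.1 hk).2).trans ?_
    rw [← ENNReal.ofReal_sum_of_nonneg fun k _ => div_nonneg (hw0 k) hc0.le, ← Finset.sum_div]
    refine ENNReal.ofReal_le_ofReal (le_trans ?_ (exp_neg_rpow_le hz0 hs0 hzs))
    gcongr
  refine (add_le_add hT hU).trans (le_of_eq ?_)
  rw [← ENNReal.ofReal_add (Real.exp_pos _).le (Real.exp_pos _).le, two_mul]

end Concentration


section TwoSided

variable {Ω : Type w} {𝒳 : Type u} {𝒴 : Type v} [MeasurableSpace Ω]
  [MetricSpace 𝒳] [MeasurableSpace 𝒳] [MetricSpace 𝒴] [MeasurableSpace 𝒴]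
  {μ : Measure Ω} {Pε : Measure 𝒴} {ε : ℕ → Ω → 𝒴} {X : ℕ → Ω → 𝒳}
  {F : ℕ → 𝒳 → 𝒴 → 𝒳} {ρ τ ξ : ℕ → ℝ}
  [BorelSpace 𝒳] [SecondCountableTopology 𝒳] [BorelSpace 𝒴] [SecondCountableTopology 𝒴]
  {q A₁ : ℝ}

lemma IsChain.increment_centered [IsProbabilityMeasure μ] (hC : IsChain μ Pε ε X F ρ τ ξ)
    (hq0 : 0 < q)
    (hA : ∫⁻ y, meanDist Pε y ^ 2 * expPow q (meanDist Pε y) ∂Pε ≤ ENNReal.ofReal A₁)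
    {k : ℕ} (hk : 1 ≤ k) {L L' : ℝ} (hL : 0 ≤ L) {g : (ℕ → 𝒳) → ℝ} (hg : PathLip (k + 1) L g)
    (hg' : PathLip k L' (backStep F Pε k g)) :
    Integrable (fun ω => g (path X ω) - backStep F Pε k g (path X ω)) μ ∧
      ∫ ω, (g (path X ω) - backStep F Pε k g (path X ω)) ∂μ = 0 := by
  have hP := hC.isProbabilityMeasure
  have hG := meanDist_ne_top_of_moment hq0 hA
  set Φ : (ℕ → 𝒳) × 𝒴 → ℝ := fun p =>
    g (Function.update p.1 (k + 1) (F (k + 1) (p.1 k) p.2)) - backStep F Pε k g p.1 with hΦ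
  have hΦm : Measurable Φ := (hg.measurable.comp (hC.measurable_step hk)).sub
    (hg'.measurable.comp measurable_fst)
  have heq : ∀ ω, g (path X ω) - backStep F Pε k g (path X ω) =
      Φ (hist X k ω, ε (k + 1) ω) := fun ω => by
    rw [hC.path_eq_step hg hk, hg'.path_eq hk le_rfl]
  have hεm := hC.measurable_noise (k + 1) (by omega)
  have hm : Measurable fun ω => (hist X k ω, ε (k + 1) ω) := (hC.measurable_hist hk).prodMk hεm
  have hint : Integrable (fun ω => Φ (hist X k ω, ε (k + 1) ω)) μ := by
    have hi : Integrable (fun y => L * τ (k + 1) * (meanDist Pε y).toReal + L * ξ (k + 1))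
        (μ.map (ε (k + 1))) := by
      rw [hC.law_noise (k + 1) (by omega)]
      exact ((integrable_toReal_meanDist hq0 hA).const_mul _).add (integrable_const _)
    refine (hi.comp_measurable hεm).mono' (hΦm.comp hm).aestronglyMeasurable
      (ae_of_all _ fun ω => ?_)
    exact hC.abs_sub_backStep_le hk hG hL hg _ _
  simp only [heq]
  refine ⟨hint, ?_⟩
  rw [← integral_map hm.aemeasurable hΦm.aestronglyMeasurable, hC.map_hist_noise hk,
    integral_prod]
  · refine integral_eq_zero_of_ae (ae_of_all _ fun h => ?_)
    simp only [hΦ]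
    rw [integral_sub (hC.integrable_step hk hG hL hg h) (integrable_const _)]
    simp [backStep]
  · rw [← hC.map_hist_noise hk]
    exact (integrable_map_measure hΦm.aestronglyMeasurable hm.aemeasurable).2 hint

/-- The conditional means given `X 1, …, X k` are integrable with the same expectation. -/
lemma IsChain.integral_condMean [IsProbabilityMeasure μ] (hC : IsChain μ Pε ε X F ρ τ ξ)
    (hq0 : 0 < q)
    (hA : ∫⁻ y, meanDist Pε y ^ 2 * expPow q (meanDist Pε y) ∂Pε ≤ ENNReal.ofReal A₁)
    (hX : ∀ x, meanDist (μ.map (X 1)) x ≠ ∞) {n : ℕ} {ψ : (ℕ → 𝒳) → ℝ}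
    (hψ : PathLip n 1 ψ) {k : ℕ} (hk : 1 ≤ k) (hkn : k ≤ n) :
    Integrable (fun ω => condMean F Pε n ψ (n - k) (path X ω)) μ ∧
      ∫ ω, condMean F Pε n ψ (n - k) (path X ω) ∂μ =
        ∫ ω, condMean F Pε n ψ (n - 1) (path X ω) ∂μ := by
  have hP := hC.isProbabilityMeasure
  have hG := meanDist_ne_top_of_moment (P := Pε) hq0 hA
  have hg := fun k (h1 : 1 ≤ k) (h2 : k ≤ n) => hC.pathLip_condMean hG hψ h1 h2
  induction k, hk using Nat.le_induction with
  | base =>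
    refine ⟨?_, rfl⟩
    have h1 := hg 1 le_rfl hkn
    obtain ⟨ω₀⟩ : Nonempty Ω := nonempty_of_isProbabilityMeasure μ
    have hi := ((integrable_dist (hX (X 1 ω₀))).comp_measurable hC.measurable_init)
    refine ((integrable_const |condMean F Pε n ψ (n - 1) (path X ω₀)|).add
      (hi.const_mul (K ρ 1 n))).mono'
      (hC.measurable_path_comp h1 le_rfl).aestronglyMeasurable (ae_of_all _ fun ω => ?_)
    have h2 := h1 (path X ω₀) (path X ω)
    simp only [Finset.Ico_self, Finset.sum_empty, zero_add] at h2
    simp only [Pi.add_apply, Function.comp_apply, Real.norm_eq_abs]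
    set a := condMean F Pε n ψ (n - 1) (path X ω₀)
    set b := condMean F Pε n ψ (n - 1) (path X ω)
    have h3 : |b| ≤ |a| + |a - b| := by
      have := abs_add_le a (b - a)
      rw [abs_sub_comm b a] at this
      simpa using this
    exact h3.trans (by gcongr; exact h2)
  | succ k hk ih =>
    obtain ⟨ih1, ih2⟩ := ih (by omega)
    have hlt : k < n := by omega
    have hk' := hg k hk hlt.le
    rw [condMean_sub hlt] at ih1 ih2 hk'
    obtain ⟨h1, h2⟩ := hC.increment_centered hq0 hA hk (K_nonneg hC.rho_nonneg (by omega) n)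
      (hg (k + 1) (by omega) (by omega)) hk'
    have h3 : Integrable (fun ω => condMean F Pε n ψ (n - (k + 1)) (path X ω)) μ := by
      refine (h1.add ih1).congr (ae_of_all _ fun ω => ?_)
      simp
    refine ⟨h3, ?_⟩
    rw [integral_sub h3 ih1] at h2
    linarith

theorem IsChain.measureReal_abs_sub_ge_le [IsProbabilityMeasure μ]
    (hC : IsChain μ Pε ε X F ρ τ ξ) (hq0 : 0 < q) (hq1 : q < 1) (hA0 : 0 ≤ A₁)
    (hA : ∫⁻ y, meanDist Pε y ^ 2 * expPow q (meanDist Pε y) ∂Pε ≤ ENNReal.ofReal A₁)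
    (hX : ∀ x, meanDist (μ.map (X 1)) x ≠ ∞)
    {n : ℕ} (hn : 1 ≤ n) {ψ : (ℕ → 𝒳) → ℝ} (hψ : PathLip n 1 ψ) {δ W x : ℝ} (hδ : 0 < δ)
    (hτ : ∀ k, 2 ≤ k → k ≤ n → K ρ k n * τ k ≤ δ) (hξ : ∀ k, 2 ≤ k → k ≤ n → K ρ k n * ξ k ≤ δ)
    (hW : Vsq Pε ρ τ ξ q A₁ n ≤ W) (hx : 0 < x) :
    μ.real {ω | x ≤ |ψ (path X ω) - ∫ ω', ψ (path X ω') ∂μ|} ≤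
      μ.real {ω | ENNReal.ofReal (x / (2 * K ρ 1 n)) ≤ meanDist (μ.map (X 1)) (X 1 ω)} +
      4 * Real.exp (-((x / 2) ^ 2 / (2 * (W + (x / 2) ^ (2 - q) * δ ^ q)))) := by
  have hP := hC.isProbabilityMeasure
  have hG := meanDist_ne_top_of_moment (P := Pε) hq0 hA
  have hPX : IsProbabilityMeasure (μ.map (X 1)) :=
    Measure.isProbabilityMeasure_map hC.measurable_init.aemeasurable
  set g := condMean F Pε n ψ (n - 1) with hg_def
  have hg : PathLip 1 (K ρ 1 n) g := hC.pathLip_condMean hG hψ le_rfl hn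
  have hK : 1 ≤ K ρ 1 n := one_le_K hC.rho_nonneg le_rfl hn
  have hmean : ∫ ω, ψ (path X ω) ∂μ = ∫ ω, g (path X ω) ∂μ := by
    have := (hC.integral_condMean hq0 hA hX hψ hn le_rfl).2
    simpa [condMean] using this
  have hgint : Integrable (fun ω => g (path X ω)) μ :=
    (hC.integral_condMean hq0 hA hX hψ le_rfl hn).1
  have hinit : ∀ ω, |g (path X ω) - ∫ ω', g (path X ω') ∂μ| ≤
      K ρ 1 n * (meanDist (μ.map (X 1)) (X 1 ω)).toReal := by
    intro ω
    have h1 : g (path X ω) - ∫ ω', g (path X ω') ∂μ =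
        ∫ ω', (g (path X ω) - g (path X ω')) ∂μ := by
      rw [integral_sub (integrable_const _) hgint]
      simp
    have hdi : Integrable (fun ω' => dist (X 1 ω) (X 1 ω')) μ :=
      (integrable_dist (hX (X 1 ω))).comp_measurable hC.measurable_init
    have hde : ∫ ω', dist (X 1 ω) (X 1 ω') ∂μ = (meanDist (μ.map (X 1)) (X 1 ω)).toReal := by
      rw [← integral_dist_eq, integral_map hC.measurable_init.aemeasurable
        (integrable_dist (hX (X 1 ω))).1]
    rw [h1, ← hde, ← integral_const_mul]
    refine abs_integral_le_integral_abs.trans (integral_mono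
      ((integrable_const _).sub hgint).abs (hdi.const_mul _) fun ω' => ?_)
    have h2 := hg (path X ω) (path X ω')
    simpa [path] using h2
  have hneg : PathLip n 1 (fun h => -ψ h) := fun h h' => by
    rw [neg_sub_neg, abs_sub_comm]
    exact hψ h h'
  have hx2 : 0 < x / 2 := by positivity
  have hup := hC.measure_sub_condMean_ge_le hq0 hq1 hA0 hA hn hψ hδ hτ hξ hW hx2
  have hlo := hC.measure_sub_condMean_ge_le hq0 hq1 hA0 hA hn hneg hδ hτ hξ hW hx2
  rw [condMean_neg] at hlo
  rw [← hg_def] at hup hlo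
  set R := Real.exp (-((x / 2) ^ 2 / (2 * (W + (x / 2) ^ (2 - q) * δ ^ q))))
  have hR : 0 < R := Real.exp_pos _
  have hup' := ENNReal.toReal_le_of_le_ofReal (by positivity) hup
  have hlo' := ENNReal.toReal_le_of_le_ofReal (by positivity) hlo
  have hsub : {ω | x ≤ |ψ (path X ω) - ∫ ω', ψ (path X ω') ∂μ|} ⊆
      {ω | ENNReal.ofReal (x / (2 * K ρ 1 n)) ≤ meanDist (μ.map (X 1)) (X 1 ω)} ∪
      ({ω | x / 2 ≤ ψ (path X ω) - g (path X ω)} ∪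
        {ω | x / 2 ≤ -ψ (path X ω) - -g (path X ω)}) := by
    intro ω hω
    simp only [Set.mem_ofPred_eq, Set.mem_union] at hω ⊢
    by_contra hcon
    push Not at hcon
    obtain ⟨h1, h2, h3⟩ := hcon
    have h4 : (meanDist (μ.map (X 1)) (X 1 ω)).toReal < x / (2 * K ρ 1 n) := by
      rwa [← ENNReal.lt_ofReal_iff_toReal_lt (hX _)]
    have h5 : K ρ 1 n * (meanDist (μ.map (X 1)) (X 1 ω)).toReal < x / 2 := by
      calc K ρ 1 n * (meanDist (μ.map (X 1)) (X 1 ω)).toReal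
          < K ρ 1 n * (x / (2 * K ρ 1 n)) := by gcongr
        _ = x / 2 := by field_simp
    have h6 := abs_le.1 (hinit ω)
    rw [hmean] at hω
    rcases le_abs.1 hω with h | h <;> linarith
  refine (measureReal_mono hsub).trans ((measureReal_union_le _ _).trans ?_)
  refine add_le_add le_rfl ((measureReal_union_le _ _).trans ?_)
  have : (4 : ℝ) * R = 2 * R + 2 * R := by ring
  rw [this]
  exact add_le_add hup' hlo'

lemma norm_lt_of_forall_abs_lt {p : ℝ≥0∞} [Fact (1 ≤ p)] {d : ℕ} {x : ℝ} (hx : 0 < x)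
    (hd : 1 ≤ d) {v : PiLp p (fun _ : Fin d => ℝ)} (hv : ∀ j, |v j| < x) :
    ‖v‖ < (d : ℝ) ^ (1 / p.toReal) * x := by
  have hd0 : (0 : ℝ) < d := by exact_mod_cast hd
  have h1 := (PiLp.antilipschitzWith_ofLp p (fun _ : Fin d => ℝ)).le_mul_dist v 0
  have h2 : ‖WithLp.ofLp v‖ < x := (pi_norm_lt_iff hx).2 hv
  simp only [dist_zero_right, WithLp.ofLp_zero] at h1
  refine h1.trans_lt ?_
  have h3 : (((Fintype.card (Fin d) : NNReal) ^ (1 / p).toReal : NNReal) : ℝ) =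
      (d : ℝ) ^ (1 / p.toReal) := by
    simp
  rw [h3]
  gcongr

theorem IsChain.centered_tail [IsProbabilityMeasure μ]
    (hC : IsChain μ Pε ε X F ρ τ ξ) (hq0 : 0 < q) (hq1 : q < 1) (hA0 : 0 ≤ A₁)
    (hA : ∫⁻ y, meanDist Pε y ^ 2 * expPow q (meanDist Pε y) ∂Pε ≤ ENNReal.ofReal A₁)
    {p : ℝ≥0∞} [Fact (1 ≤ p)] {d n : ℕ} (hd : 1 ≤ d) (hn : 1 ≤ n)
    {f : (Fin n → 𝒳) → PiLp p (fun _ : Fin d => ℝ)} (hf : SepLipschitz f) {δ W x : ℝ}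
    (hδ : 0 < δ)
    (hτ : ∀ k, 2 ≤ k → k ≤ n → K ρ k n * τ k ≤ δ) (hξ : ∀ k, 2 ≤ k → k ≤ n → K ρ k n * ξ k ≤ δ)
    (hW : Vsq Pε ρ τ ξ q A₁ n ≤ W) (hx : 0 < x) :
    μ.real {ω | (d : ℝ) ^ (1 / p.toReal) * x ≤ ‖centered μ X f ω‖} ≤ I₁ μ X ρ d n x +
      4 * d * Real.exp (-((x / 2) ^ 2 / (2 * (W + (x / 2) ^ (2 - q) * δ ^ q)))) := by
  have hd1 : (1 : ℝ) ≤ d := by exact_mod_cast hd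
  have hPX : IsProbabilityMeasure (μ.map (X 1)) :=
    Measure.isProbabilityMeasure_map hC.measurable_init.aemeasurable
  set R := Real.exp (-((x / 2) ^ 2 / (2 * (W + (x / 2) ^ (2 - q) * δ ^ q))))
  have hR : 0 < R := Real.exp_pos _
  by_cases hX : ∀ x, meanDist (μ.map (X 1)) x ≠ ∞
  swap
  · push Not at hX
    obtain ⟨x₀, hx₀⟩ := hX
    have h : ∀ z, meanDist (μ.map (X 1)) z = ∞ := fun z => by
      by_contra hz
      exact meanDist_ne_top hz x₀ hx₀
    have hI : I₁ μ X ρ d n x = d := by simp [I₁, h]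
    rw [hI]
    have := measureReal_le_one (μ := μ)
      (s := {ω | (d : ℝ) ^ (1 / p.toReal) * x ≤ ‖centered μ X f ω‖})
    have h4 : 0 ≤ 4 * d * R := by positivity
    linarith
  set ψ : Fin d → (ℕ → 𝒳) → ℝ := fun j h => f (fun i => h (i + 1)) j with hψ_def
  have hψ : ∀ j, PathLip n 1 (ψ j) := by
    intro j h h'
    have h1 : |ψ j h - ψ j h'| ≤ ‖f (fun i => h (i + 1)) - f (fun i => h' (i + 1))‖ := by
      simpa [hψ_def] using
        PiLp.norm_apply_le (f (fun i => h (i + 1)) - f (fun i => h' (i + 1))) j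
    refine (h1.trans (hf _ _)).trans (le_of_eq ?_)
    rw [Fin.sum_univ_eq_sum_range (fun i => dist (h (i + 1)) (h' (i + 1))) n, one_mul,
      ← Finset.sum_Ico_succ_top hn (fun i => dist (h i) (h' i)), Finset.range_eq_Ico,
      Finset.sum_Ico_add' (fun i => dist (h i) (h' i)) 0 n 1]
  have hint : ∀ j, Integrable (fun ω => f (fun i => X (i + 1) ω) j) μ := by
    intro j
    have := (hC.integral_condMean hq0 hA hX (hψ j) hn le_rfl).1
    simpa [condMean, hψ_def, path] using this
  have hcoord : ∀ ω j, centered μ X f ω j = ψ j (path X ω) - ∫ ω', ψ j (path X ω') ∂μ := by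
    intro ω j
    rw [centered, PiLp.sub_apply, eval_integral_piLp hint]
    rfl
  have hsub : {ω | (d : ℝ) ^ (1 / p.toReal) * x ≤ ‖centered μ X f ω‖} ⊆
      ⋃ j ∈ (Finset.univ : Finset (Fin d)),
        {ω | x ≤ |ψ j (path X ω) - ∫ ω', ψ j (path X ω') ∂μ|} := by
    intro ω hω
    by_contra hcon
    simp only [Set.mem_iUnion, not_exists, Set.mem_ofPred_eq, not_le] at hcon
    refine absurd (norm_lt_of_forall_abs_lt hx hd (v := centered μ X f ω) fun j => ?_)
      (not_lt.2 hω)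
    rw [hcoord]
    exact hcon j (Finset.mem_univ j)
  refine (measureReal_mono hsub (measure_ne_top _ _)).trans
    ((measureReal_biUnion_finset_le _ _).trans ?_)
  refine (Finset.sum_le_sum fun j _ =>
    hC.measureReal_abs_sub_ge_le hq0 hq1 hA0 hA hX hn (hψ j) hδ hτ hξ hW hx).trans (le_of_eq ?_)
  simp only [Finset.sum_const, Finset.card_univ, Fintype.card_fin, nsmul_eq_mul, I₁, R]
  ring

lemma le_delta {n k : ℕ} (hk : 2 ≤ k) (hkn : k ≤ n) :
    K ρ k n * τ k ≤ delta ρ τ ξ n ∧ K ρ k n * ξ k ≤ delta ρ τ ξ n := by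
  have h := le_ciSup (f := fun k : Set.Icc 2 n => max (K ρ k n * τ k) (K ρ k n * ξ k))
    (Set.finite_range _).bddAbove ⟨k, hk, hkn⟩
  exact ⟨(le_max_left _ _).trans h, (le_max_right _ _).trans h⟩

lemma Vsq_le {n : ℕ} (hρ : ∀ n, 2 ≤ n → 0 ≤ ρ n) (hτ0 : ∀ n, 2 ≤ n → 0 ≤ τ n)
    (hξ0 : ∀ n, 2 ≤ n → 0 ≤ ξ n) (hA0 : 0 ≤ A₁) {δ : ℝ}
    (hτ : ∀ k, 2 ≤ k → k ≤ n → K ρ k n * τ k ≤ δ) (hξ : ∀ k, 2 ≤ k → k ≤ n → K ρ k n * ξ k ≤ δ) :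
    Vsq Pε ρ τ ξ q A₁ n ≤
      2 * Real.exp 1 * (n * (δ ^ 2 *
        (A₁ + (∫⁻ y, expPow q (meanDist Pε y) ∂Pε).toReal))) := by
  unfold Vsq
  gcongr
  set M₀ := (∫⁻ y, expPow q (meanDist Pε y) ∂Pε).toReal
  have hM₀ : 0 ≤ M₀ := ENNReal.toReal_nonneg
  have hterm : ∀ k ∈ Finset.Icc 2 n, K ρ k n ^ 2 * (τ k ^ 2 * A₁ + ξ k ^ 2 * M₀) ≤
      δ ^ 2 * (A₁ + M₀) := by
    intro k hk
    rw [Finset.mem_Icc] at hk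
    have hK := K_nonneg hρ (k := k) (by omega) n
    have h1 : (K ρ k n * τ k) ^ 2 ≤ δ ^ 2 :=
      pow_le_pow_left₀ (mul_nonneg hK (hτ0 k hk.1)) (hτ k hk.1 hk.2) 2
    have h2 : (K ρ k n * ξ k) ^ 2 ≤ δ ^ 2 :=
      pow_le_pow_left₀ (mul_nonneg hK (hξ0 k hk.1)) (hξ k hk.1 hk.2) 2
    calc K ρ k n ^ 2 * (τ k ^ 2 * A₁ + ξ k ^ 2 * M₀)
        = (K ρ k n * τ k) ^ 2 * A₁ + (K ρ k n * ξ k) ^ 2 * M₀ := by ring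
      _ ≤ δ ^ 2 * A₁ + δ ^ 2 * M₀ := by gcongr
      _ = _ := by ring
  refine (Finset.sum_le_card_nsmul _ _ _ hterm).trans ?_
  rw [nsmul_eq_mul]
  gcongr
  simp

lemma IsChain.delta_pos (hC : IsChain μ Pε ε X F ρ τ ξ) (hA0 : 0 ≤ A₁) {n : ℕ} (hn : 2 ≤ n)
    (hV : 0 < Vsq Pε ρ τ ξ q A₁ n) : 0 < delta ρ τ ξ n := by
  by_contra hcon
  have h0 : 0 ≤ delta ρ τ ξ n :=
    (mul_nonneg (K_nonneg hC.rho_nonneg (by omega) n) (hC.tau_nonneg n hn)).trans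
      (le_delta hn le_rfl).1
  have h1 : delta ρ τ ξ n = 0 := le_antisymm (not_lt.1 hcon) h0
  have h2 := Vsq_le (Pε := Pε) (q := q) (n := n) hC.rho_nonneg hC.tau_nonneg hC.xi_nonneg hA0
    (fun k h1 h2 => (le_delta (ρ := ρ) (τ := τ) (ξ := ξ) h1 h2).1)
    (fun k h1 h2 => (le_delta h1 h2).2)
  rw [h1] at h2
  simp at h2
  linarith

end TwoSided


section Asymptotics

lemma tendsto_natCast_rpow {s : ℝ} (hs : 0 < s) :
    Tendsto (fun n : ℕ => (n : ℝ) ^ s) atTop atTop :=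
  (tendsto_rpow_atTop hs).comp tendsto_natCast_atTop_atTop

lemma eventually_mul_rpow_le {a b B E : ℝ} (hab : a < b) (hE : 0 < E) :
    ∀ᶠ n : ℕ in atTop, B * (n : ℝ) ^ a ≤ E * (n : ℝ) ^ b := by
  have h := (tendsto_natCast_rpow (sub_pos.2 hab)).eventually_ge_atTop (B / E)
  filter_upwards [h, eventually_ge_atTop 1] with n hn h1
  have h0 : (0 : ℝ) < n := by exact_mod_cast h1
  have h2 : (n : ℝ) ^ b = (n : ℝ) ^ (b - a) * (n : ℝ) ^ a := by
    rw [← Real.rpow_add h0]; congr 1; ring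
  rw [div_le_iff₀ hE] at hn
  rw [h2, ← mul_assoc, mul_comm E]
  gcongr

lemma tendsto_mul_rpow_sub {s t κ C : ℝ} (hs : 0 < s) (hst : s < t) (hκ : 0 < κ) :
    Tendsto (fun n : ℕ => κ * (n : ℝ) ^ t - C * (n : ℝ) ^ s) atTop atTop := by
  have h := eventually_mul_rpow_le (B := C + 1) hst hκ
  refine tendsto_atTop_mono' _ ?_ (tendsto_natCast_rpow hs)
  filter_upwards [h] with n hn
  linarith

lemma eventually_sum_exp_le {a₁ a₂ κ C s : ℝ} {φ : ℕ → ℝ} (hs : 0 < s) (hC : C < κ)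
    (hφ : Tendsto (fun n : ℕ => φ n - C * (n : ℝ) ^ s) atTop atTop) :
    ∀ᶠ n : ℕ in atTop, a₁ * Real.exp (-φ n) + a₂ * Real.exp (-(κ * (n : ℝ) ^ s)) ≤
      Real.exp (-(C * (n : ℝ) ^ s)) := by
  have h2 : Tendsto (fun n : ℕ => (κ - C) * (n : ℝ) ^ s) atTop atTop :=
    (tendsto_natCast_rpow hs).const_mul_atTop (sub_pos.2 hC)
  have h3 : Tendsto (fun n : ℕ => a₁ * Real.exp (-(φ n - C * (n : ℝ) ^ s)) +
      a₂ * Real.exp (-((κ - C) * (n : ℝ) ^ s))) atTop (nhds (a₁ * 0 + a₂ * 0)) :=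
    ((Real.tendsto_exp_neg_atTop_nhds_zero.comp hφ).const_mul a₁).add
      ((Real.tendsto_exp_neg_atTop_nhds_zero.comp h2).const_mul a₂)
  have h4 := h3.eventually (ge_mem_nhds (show a₁ * 0 + a₂ * 0 < 1 by norm_num))
  filter_upwards [h4] with n hn
  have h5 := mul_le_mul_of_nonneg_right hn (Real.exp_pos (-(C * (n : ℝ) ^ s))).le
  rw [add_mul, mul_assoc, mul_assoc, ← Real.exp_add, ← Real.exp_add, one_mul] at h5
  have e₁ : -(φ n - C * (n : ℝ) ^ s) + -(C * (n : ℝ) ^ s) = -φ n := by ring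
  have e₂ : -((κ - C) * (n : ℝ) ^ s) + -(C * (n : ℝ) ^ s) = -(κ * (n : ℝ) ^ s) := by ring
  rwa [e₁, e₂] at h5

variable {Ω : Type w} {𝒳 : Type u} {𝒴 : Type v} [MeasurableSpace Ω]
  [MetricSpace 𝒳] [MeasurableSpace 𝒳] [MetricSpace 𝒴] [MeasurableSpace 𝒴]
  {μ : Measure Ω} {Pε : Measure 𝒴} {ε : ℕ → Ω → 𝒴} {X : ℕ → Ω → 𝒳}
  {F : ℕ → 𝒳 → 𝒴 → 𝒳} {ρ τ ξ : ℕ → ℝ} {p : ℝ≥0∞} [Fact (1 ≤ p)] {d : ℕ}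

lemma ldRate_le_of_eventually [IsProbabilityMeasure μ]
    {f : (n : ℕ) → (Fin n → 𝒳) → PiLp p (fun _ : Fin d => ℝ)} {s x C : ℝ}
    (h : ∀ᶠ n : ℕ in atTop, μ.real {ω | (n : ℝ) * x ≤ ‖centered μ X (f n) ω‖} ≤
      Real.exp (-(C * (n : ℝ) ^ s))) : ldRate μ X f s x ≤ ((-C : ℝ) : EReal) := by
  unfold ldRate
  refine limsup_le_of_le (by isBoundedDefault) ?_
  filter_upwards [h, eventually_ge_atTop 1] with n hn h1
  have h0 : (0 : ℝ) < n := by exact_mod_cast h1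
  have hp : 0 < (n : ℝ) ^ s := Real.rpow_pos_of_pos h0 s
  have hle : μ {ω | (n : ℝ) * x ≤ ‖centered μ X (f n) ω‖} ≤
      ENNReal.ofReal (Real.exp (-(C * (n : ℝ) ^ s))) := by
    rw [← ofReal_measureReal]
    exact ENNReal.ofReal_le_ofReal hn
  have hlog : ENNReal.log (μ {ω | (n : ℝ) * x ≤ ‖centered μ X (f n) ω‖}) ≤
      ((-(C * (n : ℝ) ^ s) : ℝ) : EReal) := by
    refine (ENNReal.log_monotone hle).trans (le_of_eq ?_)
    rw [ENNReal.log_ofReal_of_pos (Real.exp_pos _), Real.log_exp]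
  calc ((1 / (n : ℝ) ^ s : ℝ) : EReal) *
        ENNReal.log (μ {ω | (n : ℝ) * x ≤ ‖centered μ X (f n) ω‖})
      ≤ ((1 / (n : ℝ) ^ s : ℝ) : EReal) * ((-(C * (n : ℝ) ^ s) : ℝ) : EReal) :=
        mul_le_mul_of_nonneg_left hlog (by exact_mod_cast (by positivity))
    _ = ((-C : ℝ) : EReal) := by
        rw [← EReal.coe_mul]
        congr 1
        field_simp

variable [BorelSpace 𝒳] [SecondCountableTopology 𝒳] [BorelSpace 𝒴] [SecondCountableTopology 𝒴]
  {q A₁ : ℝ}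

/-- The constant `1 / (2 d^{1/p})`. -/
noncomputable def scale (p : ℝ≥0∞) (d : ℕ) : ℝ := 1 / (2 * (d : ℝ) ^ (1 / p.toReal))

lemma scale_pos (p : ℝ≥0∞) {d : ℕ} (hd : 1 ≤ d) : 0 < scale p d := by
  have hd0 : (0 : ℝ) < d := by exact_mod_cast hd
  have := Real.rpow_pos_of_pos hd0 (1 / p.toReal)
  unfold scale
  positivity

/-- The variance constant when `δ_n ≤ D n^β`. -/
noncomputable def varConst (D A : ℝ) : ℝ := 2 * Real.exp 1 * (D ^ 2 * (2 * |A| + Real.exp 1))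

lemma varConst_pos {D : ℝ} (hD : 0 < D) (A : ℝ) : 0 < varConst D A := by
  have := Real.exp_pos 1
  unfold varConst
  positivity

theorem IsChain.ldRate_le [IsProbabilityMeasure μ]
    (hC : IsChain μ Pε ε X F ρ τ ξ) (hq0 : 0 < q) (hq1 : q < 1) (hA0 : 0 < A₁)
    (hA : ∫⁻ y, meanDist Pε y ^ 2 * expPow q (meanDist Pε y) ∂Pε ≤ ENNReal.ofReal A₁)
    (hd : 1 ≤ d) {f : (n : ℕ) → (Fin n → 𝒳) → PiLp p (fun _ : Fin d => ℝ)}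
    (hf : ∀ n, 2 ≤ n → SepLipschitz (f n)) {c : ℝ} (hc : 0 < c)
    (htail : ∀ x : ℝ, 0 < x →
      μ.real {ω | ENNReal.ofReal x ≤ meanDist (μ.map (X 1)) (X 1 ω)} ≤
        c⁻¹ * Real.exp (-(c * x ^ q)))
    {β D K₁ : ℝ} (hD : 0 < D) (hK₁ : ∀ n, 2 ≤ n → K ρ 1 n ≤ K₁)
    (hτ : ∀ n k : ℕ, 2 ≤ k → k ≤ n → K ρ k n * τ k ≤ D * (n : ℝ) ^ β)
    (hξ : ∀ n k : ℕ, 2 ≤ k → k ≤ n → K ρ k n * ξ k ≤ D * (n : ℝ) ^ β)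
    {x : ℝ} (hx : 0 < x) {M e C : ℝ} (hM : 0 < M) (he : e < 2)
    (hev : ∀ᶠ n : ℕ in atTop, varConst D A₁ * (n : ℝ) ^ (1 + 2 * β) +
      (scale p d * x) ^ (2 - q) * D ^ q * (n : ℝ) ^ (2 - q + β * q) ≤ M * (n : ℝ) ^ e)
    (hCM : C < (scale p d * x) ^ 2 / (2 * M))
    (hCt : Tendsto (fun n : ℕ => c * (scale p d * x / K₁) ^ q * (n : ℝ) ^ q -
      C * (n : ℝ) ^ (2 - e)) atTop atTop) :
    ldRate μ X f (2 - e) x ≤ ((-C : ℝ) : EReal) := by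
  have hP := hC.isProbabilityMeasure
  refine ldRate_le_of_eventually ?_
  have hd0 : (0 : ℝ) < d := by exact_mod_cast hd
  have hdp : 0 < (d : ℝ) ^ (1 / p.toReal) := Real.rpow_pos_of_pos hd0 _
  set x₀ := scale p d * x with hx₀_def
  have hx₀ : 0 < x₀ := mul_pos (scale_pos p hd) hx
  have hsum := eventually_sum_exp_le (a₁ := d * c⁻¹) (a₂ := 4 * d) (by linarith : 0 < 2 - e)
    hCM hCt
  filter_upwards [hsum, hev, eventually_ge_atTop 2] with n hn hle h2
  have hn0 : (0 : ℝ) < n := by exact_mod_cast (by omega : 0 < n)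
  refine le_trans ?_ hn
  have hK1 : 1 ≤ K ρ 1 n := one_le_K hC.rho_nonneg le_rfl (by omega)
  have hK1' := hK₁ n h2
  have hK0 : 0 < K₁ := by linarith
  set N : ℝ := (n : ℝ) with hN
  have hδ : 0 < D * N ^ β := by positivity
  have hW : Vsq Pε ρ τ ξ q A₁ n ≤ varConst D A₁ * N ^ (1 + 2 * β) := by
    refine (Vsq_le hC.rho_nonneg hC.tau_nonneg hC.xi_nonneg hA0.le (hτ n) (hξ n)).trans ?_
    have h3 := lintegral_expPow_le hq0 hA0.le hA
    have h4 : N ^ (1 + 2 * β) = N * (N ^ β) ^ 2 := by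
      rw [Real.rpow_add hn0, Real.rpow_one, ← Real.rpow_natCast (N ^ β) 2, ← Real.rpow_mul hn0.le]
      congr 2
      push_cast
      ring
    rw [h4, varConst, abs_of_pos hA0]
    calc 2 * Real.exp 1 * (N * ((D * N ^ β) ^ 2 *
          (A₁ + (∫⁻ y, expPow q (meanDist Pε y) ∂Pε).toReal)))
        ≤ 2 * Real.exp 1 * (N * ((D * N ^ β) ^ 2 * (A₁ + (Real.exp 1 + A₁)))) := by gcongr
      _ = _ := by ring
  have hxn : 0 < N * x / (d : ℝ) ^ (1 / p.toReal) := by positivity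
  have key := hC.centered_tail hq0 hq1 hA0.le hA hd (by omega : 1 ≤ n) (hf n h2) hδ
    (hτ n) (hξ n) hW hxn
  rw [mul_div_cancel₀ _ hdp.ne'] at key
  have hhalf : N * x / (d : ℝ) ^ (1 / p.toReal) / 2 = N * x₀ := by
    rw [hx₀_def, scale]; field_simp
  rw [hhalf] at key
  refine key.trans (add_le_add ?_ ?_)
  · have h3 : N * x / (d : ℝ) ^ (1 / p.toReal) / (2 * K ρ 1 n) = N * x₀ / K ρ 1 n := by
      rw [← hhalf]; field_simp
    rw [I₁, h3, mul_assoc]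
    refine mul_le_mul_of_nonneg_left ((htail _ (by positivity)).trans ?_) hd0.le
    refine mul_le_mul_of_nonneg_left (Real.exp_le_exp.2 (neg_le_neg ?_)) (inv_pos.2 hc).le
    rw [mul_assoc, ← Real.mul_rpow (by positivity) hn0.le]
    gcongr
    rw [div_mul_eq_mul_div, mul_comm x₀ N]
    gcongr
  · refine mul_le_mul_of_nonneg_left (Real.exp_le_exp.2 (neg_le_neg ?_)) (by positivity)
    have hb : (N * x₀) ^ (2 - q) * (D * N ^ β) ^ q = x₀ ^ (2 - q) * D ^ q * N ^ (2 - q + β * q) := by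
      rw [Real.mul_rpow hn0.le hx₀.le, Real.mul_rpow hD.le (by positivity), ← Real.rpow_mul hn0.le,
        Real.rpow_add hn0]
      ring
    rw [hb]
    have hB := varConst_pos hD A₁
    calc x₀ ^ 2 / (2 * M) * N ^ (2 - e) = (N * x₀) ^ 2 / (2 * (M * N ^ e)) := by
          rw [Real.rpow_sub hn0, ← Real.rpow_natCast (N * x₀) 2,
            Real.mul_rpow hn0.le hx₀.le]
          norm_num
          field_simp
      _ ≤ _ := by gcongr

end Asymptotics


section Regimes

variable {Ω : Type w} {𝒳 : Type u} {𝒴 : Type v} [MeasurableSpace Ω]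
  [MetricSpace 𝒳] [MeasurableSpace 𝒳] [MetricSpace 𝒴] [MeasurableSpace 𝒴]
  {μ : Measure Ω} {Pε : Measure 𝒴} {ε : ℕ → Ω → 𝒴} {X : ℕ → Ω → 𝒳}
  {F : ℕ → 𝒳 → 𝒴 → 𝒳} {ρ τ ξ : ℕ → ℝ} {p : ℝ≥0∞} [Fact (1 ≤ p)] {d : ℕ}
  [BorelSpace 𝒳] [SecondCountableTopology 𝒳] [BorelSpace 𝒴] [SecondCountableTopology 𝒴]
  {q A₁ : ℝ}

/-- The regime where the term `x^{2-q} δ_n^q` dominates the variance. -/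
theorem IsChain.ldRate_le_of_heavy [IsProbabilityMeasure μ]
    (hC : IsChain μ Pε ε X F ρ τ ξ) (hq0 : 0 < q) (hq1 : q < 1) (hA0 : 0 < A₁)
    (hA : ∫⁻ y, meanDist Pε y ^ 2 * expPow q (meanDist Pε y) ∂Pε ≤ ENNReal.ofReal A₁)
    (hd : 1 ≤ d) {f : (n : ℕ) → (Fin n → 𝒳) → PiLp p (fun _ : Fin d => ℝ)}
    (hf : ∀ n, 2 ≤ n → SepLipschitz (f n)) {c : ℝ} (hc : 0 < c)
    (htail : ∀ x : ℝ, 0 < x →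
      μ.real {ω | ENNReal.ofReal x ≤ meanDist (μ.map (X 1)) (X 1 ω)} ≤
        c⁻¹ * Real.exp (-(c * x ^ q)))
    {β D K₁ : ℝ} (hD : 0 < D) (hK₁ : ∀ n, 2 ≤ n → K ρ 1 n ≤ K₁)
    (hτ : ∀ n k : ℕ, 2 ≤ k → k ≤ n → K ρ k n * τ k ≤ D * (n : ℝ) ^ β)
    (hξ : ∀ n k : ℕ, 2 ≤ k → k ≤ n → K ρ k n * ξ k ≤ D * (n : ℝ) ^ β)
    (hβ : β < (1 - q) / (2 - q))
    {x : ℝ} (hx : 0 < x) {C : ℝ} (hCx : C < (scale p d / D) ^ q / 4 * x ^ q)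
    (hCt : Tendsto (fun n : ℕ => c * (scale p d * x / K₁) ^ q * (n : ℝ) ^ q -
      C * (n : ℝ) ^ (q * (1 - β))) atTop atTop) :
    ldRate μ X f (q * (1 - β)) x ≤ ((-C : ℝ) : EReal) := by
  have hsc := scale_pos p hd
  have hx₀ : 0 < scale p d * x := mul_pos hsc hx
  rw [lt_div_iff₀ (by linarith)] at hβ
  have hE : 0 < (scale p d * x) ^ (2 - q) * D ^ q := by positivity
  have hs : 2 - (2 - q + β * q) = q * (1 - β) := by ring
  have h := hC.ldRate_le (e := 2 - q + β * q) (C := C)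
    (M := 2 * ((scale p d * x) ^ (2 - q) * D ^ q)) hq0 hq1 hA0 hA hd hf hc htail hD hK₁ hτ hξ hx
    (by positivity) (by nlinarith) ?_ ?_ (by rwa [hs])
  · rwa [hs] at h
  · filter_upwards [eventually_mul_rpow_le (B := varConst D A₁)
      (show 1 + 2 * β < 2 - q + β * q by linarith) hE] with n hn
    linarith
  · refine hCx.trans_le (le_of_eq ?_)
    rw [Real.div_rpow hsc.le hD.le, Real.rpow_sub hx₀, Real.mul_rpow (z := q) hsc.le hx.le,
      Real.rpow_two]
    field_simp
    norm_num

theorem IsChain.ldRate_le_of_bounded [IsProbabilityMeasure μ]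
    (hC : IsChain μ Pε ε X F ρ τ ξ) (hq0 : 0 < q) (hq1 : q < 1) (hA0 : 0 < A₁)
    (hA : ∫⁻ y, meanDist Pε y ^ 2 * expPow q (meanDist Pε y) ∂Pε ≤ ENNReal.ofReal A₁)
    (hd : 1 ≤ d) {f : (n : ℕ) → (Fin n → 𝒳) → PiLp p (fun _ : Fin d => ℝ)}
    (hf : ∀ n, 2 ≤ n → SepLipschitz (f n)) {c : ℝ} (hc : 0 < c)
    (htail : ∀ x : ℝ, 0 < x →
      μ.real {ω | ENNReal.ofReal x ≤ meanDist (μ.map (X 1)) (X 1 ω)} ≤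
        c⁻¹ * Real.exp (-(c * x ^ q)))
    {D K₁ : ℝ} (hD : 0 < D) (hK0 : 0 < K₁) (hK₁ : ∀ n, 2 ≤ n → K ρ 1 n ≤ K₁)
    (hτ : ∀ n k : ℕ, 2 ≤ k → k ≤ n → K ρ k n * τ k ≤ D)
    (hξ : ∀ n k : ℕ, 2 ≤ k → k ≤ n → K ρ k n * ξ k ≤ D)
    {x : ℝ} (hx : 0 < x) {C : ℝ} (hC1 : C < c * (scale p d / K₁) ^ q)
    (hC2 : C < (scale p d / D) ^ q / 4) :
    ldRate μ X f q x ≤ ((-(C * x ^ q) : ℝ) : EReal) := by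
  have hsc := scale_pos p hd
  have hxq : 0 < x ^ q := Real.rpow_pos_of_pos hx q
  have h := hC.ldRate_le_of_heavy (β := 0) (C := C * x ^ q) hq0 hq1 hA0 hA hd hf hc htail hD hK₁
    (by simpa using hτ) (by simpa using hξ) (by apply div_pos <;> linarith) hx (by gcongr) ?_
  · simpa using h
  · have h1 : 0 < (c * (scale p d / K₁) ^ q - C) * x ^ q := mul_pos (by linarith) hxq
    refine ((tendsto_natCast_rpow hq0).const_mul_atTop h1).congr fun n => ?_
    have h2 : (scale p d * x / K₁) ^ q = (scale p d / K₁) ^ q * x ^ q := by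
      rw [← Real.mul_rpow (by positivity) hx.le]
      congr 1
      ring
    rw [h2, sub_zero, mul_one]
    ring

/-- The critical regime. -/
theorem IsChain.ldRate_le_of_critical [IsProbabilityMeasure μ]
    (hC : IsChain μ Pε ε X F ρ τ ξ) (hq0 : 0 < q) (hq1 : q < 1) (hA0 : 0 < A₁)
    (hA : ∫⁻ y, meanDist Pε y ^ 2 * expPow q (meanDist Pε y) ∂Pε ≤ ENNReal.ofReal A₁)
    (hd : 1 ≤ d) {f : (n : ℕ) → (Fin n → 𝒳) → PiLp p (fun _ : Fin d => ℝ)}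
    (hf : ∀ n, 2 ≤ n → SepLipschitz (f n)) {c : ℝ} (hc : 0 < c)
    (htail : ∀ x : ℝ, 0 < x →
      μ.real {ω | ENNReal.ofReal x ≤ meanDist (μ.map (X 1)) (X 1 ω)} ≤
        c⁻¹ * Real.exp (-(c * x ^ q)))
    {β D K₁ : ℝ} (hD : 0 < D) (hK0 : 0 < K₁) (hK₁ : ∀ n, 2 ≤ n → K ρ 1 n ≤ K₁)
    (hτ : ∀ n k : ℕ, 2 ≤ k → k ≤ n → K ρ k n * τ k ≤ D * (n : ℝ) ^ β)
    (hξ : ∀ n k : ℕ, 2 ≤ k → k ≤ n → K ρ k n * ξ k ≤ D * (n : ℝ) ^ β)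
    (hβ : β = (1 - q) / (2 - q)) {x : ℝ} (hx : 0 < x) {C : ℝ}
    (hC0 : C < scale p d ^ 2 / (2 * (varConst D A₁ + scale p d ^ (2 - q) * D ^ q))) :
    ldRate μ X f (q / (2 - q)) x ≤
      ((-(C * (if 1 ≤ x then x ^ q else x ^ 2)) : ℝ) : EReal) := by
  have hsc := scale_pos p hd
  have hB := varConst_pos hD A₁
  have hx₀ : 0 < scale p d * x := mul_pos hsc hx
  have h2q : 0 < 2 - q := by linarith
  have hs : 2 - (1 + 2 * β) = q / (2 - q) := by rw [hβ]; field_simp; ring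
  have hab : 2 - q + β * q = 1 + 2 * β := by rw [hβ]; field_simp; ring
  have hspos : 0 < q / (2 - q) := by positivity
  have hsq : q / (2 - q) < q := by rw [div_lt_iff₀ h2q]; nlinarith
  have hxs : (scale p d * x) ^ (2 - q) = scale p d ^ (2 - q) * x ^ (2 - q) :=
    Real.mul_rpow hsc.le hx.le
  have h := hC.ldRate_le (e := 1 + 2 * β) (C := C * (if 1 ≤ x then x ^ q else x ^ 2))
    (M := varConst D A₁ + (scale p d * x) ^ (2 - q) * D ^ q) hq0 hq1 hA0 hA hd hf hc htail hD
    hK₁ hτ hξ hx (by positivity) (by linarith) ?_ ?_ ?_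
  · rwa [hs] at h
  · refine Eventually.of_forall fun n => le_of_eq ?_
    rw [hab]
    ring
  · set G := scale p d ^ (2 - q) * D ^ q with hG
    have hG0 : 0 < G := by positivity
    rw [hxs, show scale p d ^ (2 - q) * x ^ (2 - q) * D ^ q = x ^ (2 - q) * G by rw [hG]; ring]
    split_ifs with h1
    · have hx1 : 1 ≤ x ^ (2 - q) := Real.one_le_rpow h1 h2q.le
      have hxx : x ^ q * x ^ (2 - q) = x ^ 2 := by
        rw [← Real.rpow_add hx, ← Real.rpow_two]; congr 1; ring
      calc C * x ^ q < scale p d ^ 2 / (2 * (varConst D A₁ + G)) * x ^ q := by gcongr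
        _ = (scale p d * x) ^ 2 / (2 * (x ^ (2 - q) * (varConst D A₁ + G))) := by
            rw [mul_pow, ← hxx]; field_simp
        _ ≤ _ := by
            gcongr
            nlinarith
    · have hx1 : x ^ (2 - q) ≤ 1 := Real.rpow_le_one hx.le (not_le.1 h1).le h2q.le
      calc C * x ^ 2 < scale p d ^ 2 / (2 * (varConst D A₁ + G)) * x ^ 2 := by gcongr
        _ = (scale p d * x) ^ 2 / (2 * (varConst D A₁ + G)) := by rw [mul_pow]; ring
        _ ≤ _ := by
            gcongr
            nlinarith
  · rw [hs]
    exact tendsto_mul_rpow_sub hspos hsq (by positivity)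

/-- The Gaussian regime, where the variance dominates. -/
theorem IsChain.ldRate_le_of_gaussian [IsProbabilityMeasure μ]
    (hC : IsChain μ Pε ε X F ρ τ ξ) (hq0 : 0 < q) (hq1 : q < 1) (hA0 : 0 < A₁)
    (hA : ∫⁻ y, meanDist Pε y ^ 2 * expPow q (meanDist Pε y) ∂Pε ≤ ENNReal.ofReal A₁)
    (hd : 1 ≤ d) {f : (n : ℕ) → (Fin n → 𝒳) → PiLp p (fun _ : Fin d => ℝ)}
    (hf : ∀ n, 2 ≤ n → SepLipschitz (f n)) {c : ℝ} (hc : 0 < c)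
    (htail : ∀ x : ℝ, 0 < x →
      μ.real {ω | ENNReal.ofReal x ≤ meanDist (μ.map (X 1)) (X 1 ω)} ≤
        c⁻¹ * Real.exp (-(c * x ^ q)))
    {β D K₁ : ℝ} (hD : 0 < D) (hK0 : 0 < K₁) (hK₁ : ∀ n, 2 ≤ n → K ρ 1 n ≤ K₁)
    (hτ : ∀ n k : ℕ, 2 ≤ k → k ≤ n → K ρ k n * τ k ≤ D * (n : ℝ) ^ β)
    (hξ : ∀ n k : ℕ, 2 ≤ k → k ≤ n → K ρ k n * ξ k ≤ D * (n : ℝ) ^ β)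
    (hβ : (1 - q) / (2 - q) < β) (hβ2 : β < 1 / 2) {x : ℝ} (hx : 0 < x) {C : ℝ}
    (hC0 : C < scale p d ^ 2 / (4 * varConst D A₁)) :
    ldRate μ X f (1 - 2 * β) x ≤ ((-(C * x ^ 2) : ℝ) : EReal) := by
  have hsc := scale_pos p hd
  have hB := varConst_pos hD A₁
  have hx₀ : 0 < scale p d * x := mul_pos hsc hx
  have h2q : 0 < 2 - q := by linarith
  rw [div_lt_iff₀ h2q] at hβ
  have hs : 2 - (1 + 2 * β) = 1 - 2 * β := by ring
  have h := hC.ldRate_le (e := 1 + 2 * β) (C := C * x ^ 2)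
    (M := 2 * varConst D A₁) hq0 hq1 hA0 hA hd hf hc htail hD
    hK₁ hτ hξ hx (by positivity) (by linarith) ?_ ?_ ?_
  · rwa [hs] at h
  · filter_upwards [eventually_mul_rpow_le (B := (scale p d * x) ^ (2 - q) * D ^ q)
      (show 2 - q + β * q < 1 + 2 * β by linarith) hB] with n hn
    linarith
  · calc C * x ^ 2 < scale p d ^ 2 / (4 * varConst D A₁) * x ^ 2 := by gcongr
      _ = _ := by rw [mul_pow]; field_simp; norm_num
  · rw [hs]
    refine tendsto_mul_rpow_sub (by linarith) ?_ (by positivity)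
    have h3 : 0 < (1 - q) * (1 - 2 * β) := mul_pos (by linarith) (by linarith)
    have h4 : 0 < q * (1 - β) := mul_pos hq0 (by linarith)
    nlinarith

end Regimes

end IteratedRandom

open IteratedRandom in
/-- The large deviation constants are functions of `(α, r, η)` and, where indicated by a further
argument, of the tail constant `c` or of the moment bound `A₁`; they may also depend on
`p`, `d`, `q`, but on nothing else. -/
theorem proposition3p2 (p : ℝ≥0∞) [Fact (1 ≤ p)] (d : ℕ) (hd : 1 ≤ d) (q : ℝ) (hq0 : 0 < q)
    (hq1 : q < 1) :
    ∃ (C₁ C₂ : (α r η c : ℝ) → ℝ) (C₃ : (α r η : ℝ) → ℝ) (C₄ C₅ : (α r η A₁ : ℝ) → ℝ),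
      (∀ α r η c, 0 < C₁ α r η c) ∧ (∀ α r η c, 0 < C₂ α r η c) ∧ (∀ α r η, 0 < C₃ α r η) ∧
      (∀ α r η A₁, 0 < C₄ α r η A₁) ∧ (∀ α r η A₁, 0 < C₅ α r η A₁) ∧
      ∀ (Ω : Type w) (𝒳 : Type u) (𝒴 : Type v) [MeasurableSpace Ω]
        [MetricSpace 𝒳] [CompleteSpace 𝒳] [TopologicalSpace.SeparableSpace 𝒳]
        [MeasurableSpace 𝒳] [BorelSpace 𝒳]
        [MetricSpace 𝒴] [CompleteSpace 𝒴] [TopologicalSpace.SeparableSpace 𝒴]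
        [MeasurableSpace 𝒴] [BorelSpace 𝒴]
        (μ : Measure Ω) [IsProbabilityMeasure μ] (Pε : Measure 𝒴)
        (ε : ℕ → Ω → 𝒴) (X : ℕ → Ω → 𝒳) (F : ℕ → 𝒳 → 𝒴 → 𝒳) (ρ τ ξ : ℕ → ℝ)
        (_ : IsChain μ Pε ε X F ρ τ ξ)
        (f : (n : ℕ) → (Fin n → 𝒳) → PiLp p (fun _ : Fin d => ℝ))
        (_ : ∀ n, 2 ≤ n → SepLipschitz (f n))
        (A₁ : ℝ) (_ : 0 < A₁)
        (_ : ∫⁻ y, meanDist Pε y ^ 2 * expPow q (meanDist Pε y) ∂Pε ≤ ENNReal.ofReal A₁),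
        (∀ n, 2 ≤ n → 1 ≤ √(Vsq Pε ρ τ ξ q A₁ n) → ∀ x : ℝ, 0 < x →
          μ.real {ω | (d : ℝ) ^ (1 / p.toReal) * x ≤ ‖centered μ X (f n) ω‖} ≤
            I₁ μ X ρ d n x + 4 * d * Real.exp (-((x / 2) ^ 2 /
              (2 * (Vsq Pε ρ τ ξ q A₁ n + (x / 2) ^ (2 - q) * delta ρ τ ξ n ^ q))))) ∧
        ∀ c : ℝ, 0 < c →
          (∀ x : ℝ, 0 < x →
            μ.real {ω | ENNReal.ofReal x ≤ meanDist (μ.map (X 1)) (X 1 ω)} ≤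
              c⁻¹ * Real.exp (-(c * x ^ q))) →
          (∀ α r η, VanishingBoth ρ τ ξ α r η → ∀ x : ℝ, 0 < x →
            ldRate μ X f q x ≤ ((-(C₁ α r η c * x ^ q) : ℝ) : EReal)) ∧
          (∀ α r η, VanishingNoise ρ τ ξ α r η → ∀ x : ℝ, 0 < x →
            ldRate μ X f q x ≤ ((-(C₂ α r η c * x ^ q) : ℝ) : EReal)) ∧
          (∀ α r η, VanishingContraction ρ τ ξ α r η → α < 1 / 2 →
            (α < (1 - q) / (2 - q) → ∀ x : ℝ, 0 < x →
              ldRate μ X f (q * (1 - α)) x ≤ ((-(C₃ α r η * x ^ q) : ℝ) : EReal)) ∧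
            (α = (1 - q) / (2 - q) → ∀ x : ℝ, 0 < x →
              ldRate μ X f (q / (2 - q)) x ≤
                ((-(C₄ α r η A₁ * (if 1 ≤ x then x ^ q else x ^ 2)) : ℝ) : EReal)) ∧
            ((1 - q) / (2 - q) < α → ∀ x : ℝ, 0 < x →
              ldRate μ X f (1 - 2 * α) x ≤ ((-(C₅ α r η A₁ * x ^ 2) : ℝ) : EReal))) := by
  have hsc := scale_pos p hd
  choose CK hCK0 hCK using exists_K_le
  set D : ℝ → ℝ → ℝ → ℝ := fun α r η => CK α r * (|η| + 1) with hD
  have hD0 : ∀ α r η, 0 < D α r η := fun α r η => mul_pos (hCK0 α r) (by positivity)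
  set K₂ : ℝ → ℝ := fun r => |1 / (1 - r)| + 1 with hK₂
  have hK₂0 : ∀ r, 0 < K₂ r := fun r => by simp only [hK₂]; positivity
  set D₂ : ℝ → ℝ → ℝ := fun r η => K₂ r * (|η| + 1) with hD₂
  have hD₂0 : ∀ r η, 0 < D₂ r η := fun r η => mul_pos (hK₂0 r) (by positivity)
  set pc : ℝ → ℝ := fun c => if 0 < c then c else 1 with hpc
  have hpc0 : ∀ c, 0 < pc c := fun c => by simp only [hpc]; split_ifs <;> linarith
  set m₁ : ℝ → ℝ → ℝ → ℝ := fun c k D =>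
    min (c * (scale p d / k) ^ q) ((scale p d / D) ^ q / 4) with hm₁
  have hm₁0 : ∀ c k D, 0 < c → 0 < k → 0 < D → 0 < m₁ c k D := fun c k D _ _ _ =>
    lt_min (by positivity) (by positivity)
  set m₄ : ℝ → ℝ → ℝ := fun D A =>
    scale p d ^ 2 / (2 * (varConst D A + scale p d ^ (2 - q) * D ^ q)) with hm₄
  have hm₄0 : ∀ D A, 0 < D → 0 < m₄ D A := fun D A h => by
    have := varConst_pos h A
    simp only [hm₄]
    positivity
  set m₅ : ℝ → ℝ → ℝ := fun D A => scale p d ^ 2 / (4 * varConst D A) with hm₅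
  have hm₅0 : ∀ D A, 0 < D → 0 < m₅ D A := fun D A h => by
    have := varConst_pos h A
    simp only [hm₅]
    positivity
  refine ⟨fun α r η c => m₁ (pc c) (CK α r) (D α r η) / 2,
    fun _ r η c => m₁ (pc c) (K₂ r) (D₂ r η) / 2,
    fun α r η => (scale p d / D α r η) ^ q / 4 / 2,
    fun α r η A => m₄ (D α r η) A / 2, fun α r η A => m₅ (D α r η) A / 2,
    fun α r η c => half_pos (hm₁0 _ _ _ (hpc0 c) (hCK0 α r) (hD0 α r η)),
    fun _ r η c => half_pos (hm₁0 _ _ _ (hpc0 c) (hK₂0 r) (hD₂0 r η)),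
    fun α r η => half_pos (by have := hD0 α r η; positivity),
    fun α r η A => half_pos (hm₄0 _ _ (hD0 α r η)),
    fun α r η A => half_pos (hm₅0 _ _ (hD0 α r η)), ?_⟩
  intro Ω 𝒳 𝒴 _ _ _ _ _ _ _ _ _ _ _ μ _ Pε ε X F ρ τ ξ hC f hf A₁ hA0 hA
  have : SecondCountableTopology 𝒳 := UniformSpace.secondCountable_of_separable 𝒳
  have : SecondCountableTopology 𝒴 := UniformSpace.secondCountable_of_separable 𝒴
  refine ⟨fun n hn hV x hx => ?_, fun c hc htail => ⟨?_, ?_, ?_⟩⟩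
  · have hV0 : 0 < Vsq Pε ρ τ ξ q A₁ n := Real.sqrt_pos.1 (by linarith)
    exact hC.centered_tail hq0 hq1 hA0.le hA hd (by omega) (hf n hn)
      (hC.delta_pos hA0.le hn hV0) (fun k h1 h2 => (le_delta h1 h2).1)
      (fun k h1 h2 => (le_delta h1 h2).2) le_rfl hx
  · rintro α r η ⟨hα0, hα1, hr0, hr1, hη, hbd⟩ x hx
    have hK := hCK α r hα0 hα1 hr0 hr1 ρ hC.rho_nonneg fun n hn => (hbd n hn).1
    have hKm : ∀ (n k : ℕ) (t : ℝ), 2 ≤ k → k ≤ n → t ≤ η / (k : ℝ) ^ α →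
        K ρ k n * t ≤ D α r η := by
      intro n k t h1 h2 ht
      have hk0 : (0 : ℝ) < k := by exact_mod_cast (by omega : 0 < k)
      have hkp : 0 < (k : ℝ) ^ α := Real.rpow_pos_of_pos hk0 α
      have hCKp := hCK0 α r
      calc K ρ k n * t ≤ K ρ k n * (η / (k : ℝ) ^ α) :=
            mul_le_mul_of_nonneg_left ht (K_nonneg hC.rho_nonneg (by omega) n)
        _ ≤ CK α r * (k : ℝ) ^ α * (η / (k : ℝ) ^ α) := by
            gcongr
            exact hK k n (by omega) h2
        _ = CK α r * η := by field_simp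
        _ ≤ CK α r * (|η| + 1) := by
            gcongr
            linarith [le_abs_self η]
    have hm := half_lt_self (hm₁0 _ _ _ (hpc0 c) (hCK0 α r) (hD0 α r η))
    have hpcc : pc c = c := if_pos hc
    rw [hpcc] at hm
    simp only [hpcc]
    exact hC.ldRate_le_of_bounded hq0 hq1 hA0 hA hd hf hc htail (hD0 α r η) (hCK0 α r)
      (fun n hn => by simpa using hK 1 n le_rfl (by omega))
      (fun n k h1 h2 => hKm n k _ h1 h2 ((le_max_right _ _).trans (hbd k h1).2))
      (fun n k h1 h2 => hKm n k _ h1 h2 ((le_max_left _ _).trans (hbd k h1).2))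
      hx (hm.trans_le (min_le_left _ _)) (hm.trans_le (min_le_right _ _))
  · rintro α r η ⟨hα0, hα1, hr0, hr1, hη, hbd⟩ x hx
    have hK : ∀ k n, 1 ≤ k → k ≤ n → K ρ k n ≤ K₂ r := fun k n h1 h2 => by
      refine (K_le_of_rho_le hr0 hr1 hC.rho_nonneg (fun n hn => (hbd n hn).1) h1 h2).trans ?_
      simp only [hK₂]
      linarith [le_abs_self (1 / (1 - r))]
    have hKm : ∀ (n k : ℕ) (t : ℝ), 2 ≤ k → k ≤ n → 0 ≤ t → t ≤ η / (k : ℝ) ^ α →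
        K ρ k n * t ≤ D₂ r η := by
      intro n k t h1 h2 ht0 ht
      have hk1 : (1 : ℝ) ≤ (k : ℝ) ^ α :=
        Real.one_le_rpow (by exact_mod_cast (by omega : 1 ≤ k)) hα0.le
      have ht' : t ≤ |η| + 1 := by
        have := div_le_self hη.le hk1
        linarith [le_abs_self η]
      exact mul_le_mul (hK k n (by omega) h2) ht' ht0 (hK₂0 r).le
    have hm := half_lt_self (hm₁0 _ _ _ (hpc0 c) (hK₂0 r) (hD₂0 r η))
    have hpcc : pc c = c := if_pos hc
    rw [hpcc] at hm
    simp only [hpcc]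
    exact hC.ldRate_le_of_bounded hq0 hq1 hA0 hA hd hf hc htail (hD₂0 r η) (hK₂0 r)
      (fun n hn => hK 1 n le_rfl (by omega))
      (fun n k h1 h2 => hKm n k _ h1 h2 (hC.tau_nonneg k h1)
        ((le_max_right _ _).trans (hbd k h1).2))
      (fun n k h1 h2 => hKm n k _ h1 h2 (hC.xi_nonneg k h1)
        ((le_max_left _ _).trans (hbd k h1).2))
      hx (hm.trans_le (min_le_left _ _)) (hm.trans_le (min_le_right _ _))
  · rintro α r η ⟨hα0, hα1, hr0, hr1, hη, hbd⟩ hα2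
    have hK := hCK α r hα0.le hα1 hr0 hr1 ρ hC.rho_nonneg fun n hn => (hbd n hn).1
    have hK1 : ∀ n, 2 ≤ n → K ρ 1 n ≤ CK α r := fun n hn => by
      simpa using hK 1 n le_rfl (by omega)
    have hKm : ∀ (n k : ℕ) (t : ℝ), 2 ≤ k → k ≤ n → 0 ≤ t → t ≤ η →
        K ρ k n * t ≤ D α r η * (n : ℝ) ^ α := by
      intro n k t h1 h2 ht0 ht
      have hCKp := hCK0 α r
      calc K ρ k n * t ≤ CK α r * (n : ℝ) ^ α * (|η| + 1) := by
            refine mul_le_mul ((hK k n (by omega) h2).trans ?_)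
              (by linarith [le_abs_self η]) ht0 (by positivity)
            gcongr
        _ = _ := by simp only [hD]; ring
    have hτ := fun (n k : ℕ) (h1 : 2 ≤ k) (h2 : k ≤ n) =>
      hKm n k _ h1 h2 (hC.tau_nonneg k h1) ((le_max_right _ _).trans (hbd k h1).2)
    have hξ := fun (n k : ℕ) (h1 : 2 ≤ k) (h2 : k ≤ n) =>
      hKm n k _ h1 h2 (hC.xi_nonneg k h1) ((le_max_left _ _).trans (hbd k h1).2)
    have hDp := hD0 α r η
    have hCKp := hCK0 α r
    refine ⟨fun hα x hx => ?_, fun hα x hx => ?_, fun hα x hx => ?_⟩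
    · have hxq : 0 < x ^ q := Real.rpow_pos_of_pos hx q
      refine hC.ldRate_le_of_heavy hq0 hq1 hA0 hA hd hf hc htail hDp hK1 hτ hξ hα hx ?_ ?_
      · have h4 : 0 < (scale p d / D α r η) ^ q / 4 := by positivity
        exact mul_lt_mul_of_pos_right (half_lt_self h4) hxq
      · exact tendsto_mul_rpow_sub (mul_pos hq0 (by linarith)) (by nlinarith) (by positivity)
    · exact hC.ldRate_le_of_critical hq0 hq1 hA0 hA hd hf hc htail hDp hCKp hK1 hτ hξ hα hx
        (half_lt_self (hm₄0 _ _ hDp))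
    · exact hC.ldRate_le_of_gaussian hq0 hq1 hA0 hA hd hf hc htail hDp hCKp hK1 hτ hξ hα hα2 hx
        (half_lt_self (hm₅0 _ _ hDp))
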